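/- Let $m\ge 0$ be an integer and let $n$ be a positive integer. An $m$-component virtual string link diagram is an ordered and oriented $m$-component string link diagram in the plane (no closed components; the $i$-th component runs from the $i$-th bottom endpoint to the $i$-th top endpoint) whose transverse double points are classical or virtual crossings. An $m$-component welded string link is an equivalence class of such diagrams under planar isotopy and the welded Reidemeister moves: the Reidemeister moves R1–R3, the virtual moves V1–V4, and the move OC (overcrossings commute), in which a strand is passed over a virtual crossing. Consider the following local moves on diagrams. - Self-crossing virtualization (sv): a classical crossing between two strands of the same component is replaced by a virtual crossing. - $2n$-move: two neighbouring strands, with arbitrary orientations and without crossings, are replaced by the same two strands twisted around each other by $2n$ classical half twists of the same kind; in other words, $[\,\cdot\,]\leftrightarrow\sigma^{2n}$, where $\sigma$ is a classical crossing of the two strands. - $V^n$-move: two neighbouring strands, running in the same direction and without crossings, are replaced by the same two strands with $n$ successive copies of "a classical crossing followed by a virtual crossing" inserted, where the right strand is the overstrand at all $n$ classical crossings. The $(2n+\mathrm{sv})$-equivalence is the equivalence relation on welded string links generated by the $2n$-move, the self-crossing virtualization and welded isotopy. The $(V^n+\mathrm{sv})$-equivalence is the equivalence relation on welded string links generated by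 the $V^n$-move, the self-crossing virtualization and welded isotopy. If two $m$-component welded string links are $(2n+\mathrm{sv})$-equivalent, then they are $(V^n+\mathrm{sv})$-equivalent. -/

import Mathlib

namespace Welded

/-! Planar diagrams in general position with respect to the height function, read from bottom to top
as a list of elementary events, each placed at a horizontal position. -/

/-- An oriented strand crossing a horizontal level: its component, and `true` if it runs upwards. -/
abbrev Strand (m : ℕ) := Fin m × Bool

/-- The same component, running the other way. -/
def Strand.flip {m : ℕ} (s : Strand m) : Strand m := (s.1, !s.2)

/-- The strands met by a horizontal level, from left to right. -/
abbrev Level (m : ℕ) := List (Strand m)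

/-- The elementary events of an oriented diagram whose strands are labelled by components. -/
inductive Event (m : ℕ)
  /-- A classical crossing of two neighbouring strands. The strand which goes from the lower left to
  the upper right is the overstrand if the Boolean is `true`, the understrand if it is `false`. -/
  | cross (leftOver : Bool)
  /-- A virtual crossing of two neighbouring strands. -/
  | virt
  /-- A local minimum; its left branch is `s`, its right branch is `s.flip`. -/
  | cup (s : Strand m)
  /-- A local maximum. -/
  | cap

/-- The number of strands entering an event from below. -/
def Event.ins {m : ℕ} : Event m → ℕ
  | .cross _ => 2
  | .virt => 2
  | .cup _ => 0
  | .cap => 2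

/-- The number of strands leaving an event at the top. -/
def Event.outs {m : ℕ} : Event m → ℕ
  | .cross _ => 2
  | .virt => 2
  | .cup _ => 2
  | .cap => 0

/-- The level above an event placed at position `k` (there are `k` strands to the left of the event),
given the level below it; `none` if the event does not fit, that is, if there are too few strands, or
if a local maximum would join two strands that do not match. -/
def Event.step {m : ℕ} : Event m → ℕ → Level m → Option (Level m)
  | e, k + 1, x :: L => (e.step k L).map (x :: ·)
  | _, _ + 1, [] => none
  | .cross _, 0, x :: y :: L => some (y :: x :: L)
  | .virt, 0, x :: y :: L => some (y :: x :: L)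
  | .cup s, 0, L => some (s :: s.flip :: L)
  | .cap, 0, x :: y :: L => if y = x.flip then some L else none
  | _, 0, _ => none

/-- A list of events with their positions, read from bottom to top. -/
abbrev Word (m : ℕ) := List (Event m × ℕ)

/-- The level reached above a word, starting from the level `L` below it. -/
def run {m : ℕ} : Word m → Level m → Option (Level m)
  | [], L => some L
  | (e, k) :: w, L => (e.step k L).bind (run w)

/-- The boundary level of a string link: the components `0, …, m - 1` in order, all running
upwards. -/
def boundary (m : ℕ) : Level m := List.ofFn fun i : Fin m => (i, true)

/-- Points `(t, p)` and `(t', p')` (position `p` at the level below the event number `t`, and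
likewise for the other) which are joined by a piece of strand of `w` passing at most one event. -/
inductive Adj {m : ℕ} (w : Word m) : ℕ × ℕ → ℕ × ℕ → Prop
  | left {t p k : ℕ} {e : Event m} : w[t]? = some (e, k) → p < k → Adj w (t, p) (t + 1, p)
  | right {t p k : ℕ} {e : Event m} : w[t]? = some (e, k) →
      Adj w (t, k + e.ins + p) (t + 1, k + e.outs + p)
  | cross_right {t k : ℕ} {b : Bool} : w[t]? = some (.cross b, k) → Adj w (t, k) (t + 1, k + 1)
  | cross_left {t k : ℕ} {b : Bool} : w[t]? = some (.cross b, k) → Adj w (t, k + 1) (t + 1, k)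
  | virt_right {t k : ℕ} : w[t]? = some (.virt, k) → Adj w (t, k) (t + 1, k + 1)
  | virt_left {t k : ℕ} : w[t]? = some (.virt, k) → Adj w (t, k + 1) (t + 1, k)
  | cup {t k : ℕ} {s : Strand m} : w[t]? = some (.cup s, k) → Adj w (t + 1, k) (t + 1, k + 1)
  | cap {t k : ℕ} : w[t]? = some (.cap, k) → Adj w (t, k) (t, k + 1)

/-- An `m`-component virtual string link diagram: it has the `m` boundary points at the bottom and
at the top, and no closed components. As labels are constant along strands, the `i`-th component is
an arc which runs from the `i`-th point at the bottom to the `i`-th point at the top. -/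
structure StringLinkDiagram (m : ℕ) where
  word : Word m
  run_word : run word (boundary m) = some (boundary m)
  no_closed : ∀ t ≤ word.length, ∀ L : Level m, run (word.take t) (boundary m) = some L →
    ∀ p < L.length, ∃ i < m, Relation.EqvGen (Adj word) (0, i) (t, p)

/-- The local moves that generate welded isotopy. Labels are not constrained except at local
minima, so each move is allowed for all orientations of its strands. Further versions of
the moves, such as those which are rotated in the plane, are composed of these. -/
inductive WeldedMove {m : ℕ} : Word m → Word m → Prop
  /- planar isotopy: exchange of the heights of two distant events -/
  | far (e f : Event m) (k j : ℕ) :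
      WeldedMove [(e, k), (f, k + e.outs + j)] [(f, k + e.ins + j), (e, k)]
  /- planar isotopy: cancellation of a local minimum and a local maximum -/
  | zigzag_left (s : Strand m) (k : ℕ) : WeldedMove [(.cup s, k + 1), (.cap, k)] []
  | zigzag_right (s : Strand m) (k : ℕ) : WeldedMove [(.cup s, k), (.cap, k + 1)] []
  /- planar isotopy: a local extremum passes through a crossing (the crossing is rotated) -/
  | cup_cross (s : Strand m) (b : Bool) (k : ℕ) :
      WeldedMove [(.cup s, k), (.cross b, k + 1)] [(.cup s, k + 1), (.cross (!b), k)]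
  | cup_virt (s : Strand m) (k : ℕ) :
      WeldedMove [(.cup s, k), (.virt, k + 1)] [(.cup s, k + 1), (.virt, k)]
  | cap_cross (b : Bool) (k : ℕ) :
      WeldedMove [(.cross b, k), (.cap, k + 1)] [(.cross (!b), k + 1), (.cap, k)]
  | cap_virt (k : ℕ) :
      WeldedMove [(.virt, k), (.cap, k + 1)] [(.virt, k + 1), (.cap, k)]
  /- Reidemeister moves -/
  | R1 (s : Strand m) (b : Bool) (k : ℕ) :
      WeldedMove [(.cup s, k), (.cross b, k)] [(.cup s.flip, k)]
  | R2 (b : Bool) (k : ℕ) : WeldedMove [(.cross b, k), (.cross (!b), k)] []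
  | R3 (b : Bool) (k : ℕ) :
      WeldedMove [(.cross b, k), (.cross b, k + 1), (.cross b, k)]
        [(.cross b, k + 1), (.cross b, k), (.cross b, k + 1)]
  /- virtual moves -/
  | V1 (s : Strand m) (k : ℕ) : WeldedMove [(.cup s, k), (.virt, k)] [(.cup s.flip, k)]
  | V2 (k : ℕ) : WeldedMove [(.virt, k), (.virt, k)] []
  | V3 (k : ℕ) :
      WeldedMove [(.virt, k), (.virt, k + 1), (.virt, k)] [(.virt, k + 1), (.virt, k), (.virt, k + 1)]
  | V4 (b : Bool) (k : ℕ) :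
      WeldedMove [(.virt, k), (.virt, k + 1), (.cross b, k)]
        [(.cross b, k + 1), (.virt, k), (.virt, k + 1)]
  /- overcrossings commute: a strand passes over a virtual crossing -/
  | OC (k : ℕ) :
      WeldedMove [(.cross true, k), (.cross true, k + 1), (.virt, k)]
        [(.virt, k + 1), (.cross true, k), (.cross true, k + 1)]

/-- The self-crossing virtualization: a classical crossing of two strands of a single component
becomes virtual. Here and below `L` is the level at which the move takes place. -/
inductive SelfVirtualization {m : ℕ} : Level m → Word m → Word m → Prop
  | mk (L : Level m) (k : ℕ) (b : Bool) (i : Fin m) (d d' : Bool) :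
      L[k]? = some (i, d) → L[k + 1]? = some (i, d') →
      SelfVirtualization L [(.cross b, k)] [(.virt, k)]

/-- The `2n`-move: two strands which run next to each other, with any orientations, get twisted
around each other by `2n` classical half twists of the same kind. -/
inductive TwoNMove {m : ℕ} (n : ℕ) : Level m → Word m → Word m → Prop
  | mk (L : Level m) (k : ℕ) (b : Bool) :
      TwoNMove n L [] (List.replicate (2 * n) (.cross b, k))

/-- The `V^n`-move: between two neighbouring parallel strands with the same orientation, `n` times
a classical crossing followed by a virtual one is inserted; the right strand is the overstrand at
all `n` classical crossings. -/
inductive VMove {m : ℕ} (n : ℕ) : Level m → Word m → Word m → Prop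
  | mk (L : Level m) (k : ℕ) (i j : Fin m) :
      L[k]? = some (i, true) → L[k + 1]? = some (j, true) →
      VMove n L [] (List.replicate n [(Event.cross false, k), (Event.virt, k)]).flatten

/-- `D'` is obtained from `D` by one application of the local move `R`. -/
def StringLinkDiagram.Related {m : ℕ} (R : Level m → Word m → Word m → Prop)
    (D D' : StringLinkDiagram m) : Prop :=
  ∃ (a u u' b : Word m) (L : Level m), run a (boundary m) = some L ∧ R L u u' ∧
    D.word = a ++ u ++ b ∧ D'.word = a ++ u' ++ b

/-- Welded isotopy: the equivalence relation generated by the welded moves. -/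
def weldedIsotopy (m : ℕ) : Setoid (StringLinkDiagram m) :=
  Relation.EqvGen.setoid (StringLinkDiagram.Related fun _ => WeldedMove)

/-- `m`-component welded string links: diagrams up to welded isotopy. -/
def WeldedStringLink (m : ℕ) : Type := Quotient (weldedIsotopy m)

/-- The welded string link of a diagram. -/
def StringLinkDiagram.toLink {m : ℕ} (D : StringLinkDiagram m) : WeldedStringLink m :=
  Quotient.mk (weldedIsotopy m) D

/-- Two welded string links have diagrams which are related by one application of `R`. -/
def WeldedStringLink.Related {m : ℕ} (R : Level m → Word m → Word m → Prop)
    (σ σ' : WeldedStringLink m) : Prop :=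
  ∃ D D' : StringLinkDiagram m, D.toLink = σ ∧ D'.toLink = σ' ∧ D.Related R D'

/-- `(2n+sv)`-equivalence, generated by `2n`-moves and self-crossing virtualizations. -/
def TwoNSvEquivalent {m : ℕ} (n : ℕ) : WeldedStringLink m → WeldedStringLink m → Prop :=
  Relation.EqvGen fun σ σ' => WeldedStringLink.Related (TwoNMove n) σ σ' ∨
    WeldedStringLink.Related SelfVirtualization σ σ'

/-- `(V^n+sv)`-equivalence, generated by `V^n`-moves and self-crossing virtualizations. -/
def VSvEquivalent {m : ℕ} (n : ℕ) : WeldedStringLink m → WeldedStringLink m → Prop :=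
  Relation.EqvGen fun σ σ' => WeldedStringLink.Related (VMove n) σ σ' ∨
    WeldedStringLink.Related SelfVirtualization σ σ'

end Welded

namespace Welded

variable {m n : ℕ}

/-! Write σ for a classical and v for a virtual crossing of two neighbouring strands. As v² cancels,
σ² = (σv)(vσ). If the full twist σ² commutes with v, it commutes with the arrow σv, and then σ^{2n}
= (σv)^n (vσ)^n. The first factor is what a V^n-move inserts and the second is a conjugate by v of
such a factor, so both vanish (`pow_full_twist`, `pow_twist`).

Two facts carry this. Modulo sv, vσ² = σ²v (`virt_full_twist`): bending one strand brings vσ² into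
the form of a horizontal chain of three crossings, because crossings between the two arcs of the
bent strand may be virtualized and then absorbed in an extremum. Bending the other strand does the
same to σ²v, and the two chains differ by a planar rotation.

Secondly, (σv)^n vanishes for all orientations and both kinds of σ (`pow_arrow`). A bend reverses
one strand and turns arrows into their inverses. Carrying n arrows around the bend requires the
arrows on its two arcs to commute: if the bent strand lies under, this is OC; if it lies over, it is
the forbidden undercrossing move, which sv provides for arcs of one component.

Finally, every intermediate word must be a diagram without closed components. This is expressed by
colourings constant along strands, which makes it visibly invariant under the moves
(`connected_iff`, `Connected.replace`). -/

@[simp] theorem Strand.flip_flip (s : Strand m) : s.flip.flip = s := by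
  simp [Strand.flip]

@[simp] theorem run_nil (L : Level m) : run [] L = some L := rfl

@[simp] theorem run_cons (e : Event m) (k : ℕ) (w : Word m) (L : Level m) :
    run ((e, k) :: w) L = (e.step k L).bind (run w) := rfl

@[simp] theorem step_succ (e : Event m) (k : ℕ) (x : Strand m) (L : Level m) :
    e.step (k + 1) (x :: L) = (e.step k L).map (x :: ·) := by
  cases e <;> rfl

@[simp] theorem step_cross (b : Bool) (x y : Strand m) (L : Level m) :
    (Event.cross b).step 0 (x :: y :: L) = some (y :: x :: L) := rfl

@[simp] theorem step_virt (x y : Strand m) (L : Level m) :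
    Event.virt.step 0 (x :: y :: L) = some (y :: x :: L) := rfl

@[simp] theorem step_cup (s : Strand m) (L : Level m) :
    (Event.cup s).step 0 L = some (s :: s.flip :: L) := rfl

@[simp] theorem step_cap (x y : Strand m) (L : Level m) :
    Event.cap.step 0 (x :: y :: L) = if y = x.flip then some L else none := rfl

attribute [simp] Event.ins Event.outs

theorem run_append (a b : Word m) (L : Level m) :
    run (a ++ b) L = (run a L).bind (run b) := by
  induction a generalizing L with
  | nil => rfl
  | cons x a ih =>
    obtain ⟨e, k⟩ := x
    simp only [List.cons_append, run, Option.bind_assoc]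
    congr 1
    funext L'
    exact ih L'

/-! ### Equivalence of words over a fixed bottom level -/

/-- The moves generating the `(V^n+sv)`-equivalence. -/
def Basic (n : ℕ) (L : Level m) (u u' : Word m) : Prop :=
  WeldedMove u u' ∨ SelfVirtualization L u u' ∨ VMove n L u u'

/-- A generating move applied inside a word at whose bottom the level `L` is met. -/
def Step (n : ℕ) (L : Level m) (w w' : Word m) : Prop :=
  ∃ (a u u' b : Word m) (L₁ L₂ : Level m), run a L = some L₁ ∧ run u L₁ = some L₂ ∧
    run u' L₁ = some L₂ ∧ Basic n L₁ u u' ∧ w = a ++ u ++ b ∧ w' = a ++ u' ++ b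

/-- The equivalence of words over the bottom level `L` generated by the moves. -/
def Eqv (n : ℕ) (L : Level m) : Word m → Word m → Prop := Relation.EqvGen (Step n L)

namespace Eqv

theorem refl (L : Level m) (w : Word m) : Eqv n L w w := Relation.EqvGen.refl _

theorem symm {L : Level m} {w w' : Word m} (h : Eqv n L w w') : Eqv n L w' w :=
  Relation.EqvGen.symm _ _ h

theorem trans {L : Level m} {w w' w'' : Word m} (h : Eqv n L w w') (h' : Eqv n L w' w'') :
    Eqv n L w w'' :=
  Relation.EqvGen.trans _ _ _ h h'

theorem step {L L₂ : Level m} (a b : Word m) {u u' : Word m}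
    (h : ∀ L₁, run a L = some L₁ → Basic n L₁ u u')
    (h₁ : run (a ++ u) L = some L₂) (h₂ : run (a ++ u') L = some L₂) :
    Eqv n L (a ++ u ++ b) (a ++ u' ++ b) := by
  rw [run_append, Option.bind_eq_some_iff] at h₁ h₂
  obtain ⟨L₁, ha, hu⟩ := h₁
  obtain ⟨L₁', ha', hu'⟩ := h₂
  obtain rfl : L₁ = L₁' := by rw [ha] at ha'; exact Option.some.inj ha'
  exact Relation.EqvGen.rel _ _ ⟨a, u, u', b, L₁, L₂, ha, hu, hu', h _ ha, rfl, rfl⟩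

/-- The default arguments check the splitting of the words and the levels by evaluation, so a step
on concrete words only names its context and its move. -/
theorem move {L : Level m} {w w' : Word m} (a b : Word m) {u u' : Word m} (h : WeldedMove u u')
    (hw : w = a ++ u ++ b := by rfl) (hw' : w' = a ++ u' ++ b := by rfl)
    (h₁ : (run (a ++ u) L).isSome := by first | rfl | simp)
    (h₂ : run (a ++ u') L = run (a ++ u) L := by first | rfl | simp) :
    Eqv n L w w' := by
  obtain ⟨L₂, hL⟩ := Option.isSome_iff_exists.1 h₁
  subst hw hw'
  exact step a b (fun _ _ => .inl h) hL (h₂.trans hL)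

/-- A generating welded move, read backwards. -/
theorem moveBack {L : Level m} {w w' : Word m} (a b : Word m) {u u' : Word m} (h : WeldedMove u u')
    (hw : w = a ++ u' ++ b := by rfl) (hw' : w' = a ++ u ++ b := by rfl)
    (h₁ : (run (a ++ u) L).isSome := by first | rfl | simp)
    (h₂ : run (a ++ u') L = run (a ++ u) L := by first | rfl | simp) :
    Eqv n L w w' :=
  (move a b h hw' hw h₁ h₂).symm

instance (L : Level m) : Trans (Eqv n L) (Eqv n L) (Eqv n L) := ⟨trans⟩

theorem ctx {L L₁ : Level m} (a b : Word m) {u u' : Word m} (ha : run a L = some L₁)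
    (h : Eqv n L₁ u u') : Eqv n L (a ++ u ++ b) (a ++ u' ++ b) := by
  induction h with
  | rel u u' h =>
    obtain ⟨c, v, v', d, L₂, L₃, hc, hv, hv', hb, rfl, rfl⟩ := h
    refine Relation.EqvGen.rel _ _ ⟨a ++ c, v, v', d ++ b, L₂, L₃, ?_, hv, hv', hb, ?_, ?_⟩
    · simp [run_append, ha, hc]
    · simp
    · simp
  | refl => exact refl _ _
  | symm _ _ _ ih => exact ih.symm
  | trans _ _ _ _ _ ih ih' => exact ih.trans ih'

theorem run_eq {L : Level m} {w w' : Word m} (h : Eqv n L w w') : run w L = run w' L := by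
  induction h with
  | rel u u' h =>
    obtain ⟨c, v, v', d, L₂, L₃, hc, hv, hv', hb, rfl, rfl⟩ := h
    simp [run_append, hc, hv, hv']
  | refl => rfl
  | symm _ _ _ ih => exact ih.symm
  | trans _ _ _ _ _ ih ih' => exact ih.trans ih'

end Eqv

/-! ### Adding strands on the left -/

/-- Moves all events of a word by `k` positions to the right. -/
def sh (k : ℕ) (w : Word m) : Word m := w.map fun x => (x.1, x.2 + k)

theorem sh_append (k : ℕ) (a b : Word m) : sh k (a ++ b) = sh k a ++ sh k b := by simp [sh]

theorem run_sh_one (w : Word m) (x : Strand m) (L : Level m) :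
    run (sh 1 w) (x :: L) = (run w L).map (x :: ·) := by
  induction w generalizing L with
  | nil => rfl
  | cons y w ih =>
    obtain ⟨e, k⟩ := y
    simp only [sh, List.map_cons, run, step_succ, Option.bind_map, Option.map_bind]
    congr 1
    funext L'
    exact ih L'

theorem WeldedMove.sh_one {u u' : Word m} (h : WeldedMove u u') : WeldedMove (sh 1 u) (sh 1 u') := by
  cases h with
  | far e f k j =>
    have := WeldedMove.far e f (k + 1) j
    simpa [sh, add_right_comm, add_assoc, add_comm, add_left_comm] using this
  | zigzag_left s k => exact .zigzag_left s (k + 1)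
  | zigzag_right s k => exact .zigzag_right s (k + 1)
  | cup_cross s b k => exact .cup_cross s b (k + 1)
  | cup_virt s k => exact .cup_virt s (k + 1)
  | cap_cross b k => exact .cap_cross b (k + 1)
  | cap_virt k => exact .cap_virt (k + 1)
  | R1 s b k => exact .R1 s b (k + 1)
  | R2 b k => exact .R2 b (k + 1)
  | R3 b k => exact .R3 b (k + 1)
  | V1 s k => exact .V1 s (k + 1)
  | V2 k => exact .V2 (k + 1)
  | V3 k => exact .V3 (k + 1)
  | V4 b k => exact .V4 b (k + 1)
  | OC k => exact .OC (k + 1)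

theorem Basic.sh_one {L : Level m} {u u' : Word m} (x : Strand m) (h : Basic n L u u') :
    Basic n (x :: L) (sh 1 u) (sh 1 u') := by
  rcases h with h | h | h
  · exact .inl h.sh_one
  · obtain ⟨k, b, i, d, d', h, h'⟩ := h
    exact .inr (.inl (.mk _ (k + 1) b i d d' (by simpa using h) (by simpa using h')))
  · obtain ⟨k, i, j, h, h'⟩ := h
    refine .inr (.inr ?_)
    have := VMove.mk (n := n) (x :: L) (k + 1) i j (by simpa using h) (by simpa using h')
    simpa [sh, List.map_flatten, List.map_replicate] using this

theorem Eqv.sh_one {L : Level m} {u u' : Word m} (x : Strand m) (h : Eqv n L u u') :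
    Eqv n (x :: L) (sh 1 u) (sh 1 u') := by
  induction h with
  | rel u u' h =>
    obtain ⟨a, v, v', b, L₁, L₂, ha, hv, hv', hb, rfl, rfl⟩ := h
    refine Relation.EqvGen.rel _ _
      ⟨sh 1 a, sh 1 v, sh 1 v', sh 1 b, x :: L₁, x :: L₂, ?_, ?_, ?_, hb.sh_one x, ?_, ?_⟩ <;>
    simp [run_sh_one, sh_append, *]
  | refl => exact refl _ _
  | symm _ _ _ ih => exact ih.symm
  | trans _ _ _ _ _ ih ih' => exact ih.trans ih'

theorem sh_zero (w : Word m) : sh 0 w = w := by simp [sh]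

theorem sh_sh (j k : ℕ) (w : Word m) : sh j (sh k w) = sh (k + j) w := by
  simp [sh, add_assoc]

/-- Strands to the left do not interact with a move, so local identities need only be proved at the
leftmost positions. -/
theorem Eqv.shift {L : Level m} {u u' : Word m} (P : Level m) (h : Eqv n L u u') :
    Eqv n (P ++ L) (sh P.length u) (sh P.length u') := by
  induction P with
  | nil => simpa [sh_zero] using h
  | cons x P ih => simpa [sh_sh] using ih.sh_one x

/-- An equivalence of words used inside a word, to the right of the strands `P`. -/
theorem Eqv.at {L L₁ : Level m} {w w' : Word m} (a b : Word m) (P : Level m) {u u' : Word m}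
    (h : Eqv n L₁ u u') (hw : w = a ++ sh P.length u ++ b := by rfl)
    (hw' : w' = a ++ sh P.length u' ++ b := by rfl)
    (ha : run a L = some (P ++ L₁) := by first | rfl | simp) : Eqv n L w w' := by
  subst hw hw'
  exact Eqv.ctx a b ha (h.shift P)

/-- A classical crossing at position `k`. -/
abbrev cr (b : Bool) (k : ℕ) : Event m × ℕ := (.cross b, k)

/-- A virtual crossing at position `k`. -/
abbrev vi (k : ℕ) : Event m × ℕ := (.virt, k)

/-- A local minimum at position `k`. -/
abbrev cu (s : Strand m) (k : ℕ) : Event m × ℕ := (.cup s, k)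

/-- A local maximum at position `k`. -/
abbrev ca (k : ℕ) : Event m × ℕ := (.cap, k)

namespace WeldedMove

theorem R2_not (b : Bool) (k : ℕ) : WeldedMove (m := m) [cr (!b) k, cr b k] [] := by
  simpa using R2 (m := m) (!b) k

theorem cup_cross_not (s : Strand m) (b : Bool) (k : ℕ) :
    WeldedMove [cu s k, cr (!b) (k + 1)] [cu s (k + 1), cr b k] := by
  simpa using cup_cross s (!b) k

theorem cap_cross_not (b : Bool) (k : ℕ) :
    WeldedMove (m := m) [cr (!b) k, ca (k + 1)] [cr b (k + 1), ca k] := by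
  simpa using cap_cross (m := m) (!b) k

theorem V1_flip (s : Strand m) (k : ℕ) : WeldedMove [cu s.flip k, vi k] [cu s k] := by
  simpa using V1 s.flip k

end WeldedMove

open WeldedMove

/-! ### A full twist commutes with a virtual crossing -/

theorem run_crossing {e : Event m} (he : (∃ b, e = .cross b) ∨ e = .virt) (P : Level m)
    (p q : Strand m) (R : Level m) :
    run [(e, P.length)] (P ++ p :: q :: R) = some (P ++ q :: p :: R) := by
  induction P with
  | nil => rcases he with ⟨b, rfl⟩ | rfl <;> rfl
  | cons x P ih =>
    have := run_sh_one [(e, P.length)] x (P ++ p :: q :: R)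
    rw [ih] at this
    exact this

namespace Eqv

theorem selfVirtualize {L : Level m} {w w' : Word m} (a b : Word m) (P R : Level m)
    {p q : Strand m} (c : Bool) (hpq : p.1 = q.1) (hw : w = a ++ [cr c P.length] ++ b := by rfl)
    (hw' : w' = a ++ [vi P.length] ++ b := by rfl)
    (ha : run a L = some (P ++ p :: q :: R) := by first | rfl | simp) : Eqv n L w w' := by
  subst hw hw'
  refine ctx a b ha (Relation.EqvGen.rel _ _ ⟨[], _, _, [], P ++ p :: q :: R, P ++ q :: p :: R,
    rfl, run_crossing (.inl ⟨c, rfl⟩) P p q R, run_crossing (.inr rfl) P p q R, ?_, ?_, ?_⟩)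
  · exact .inr (.inl (.mk _ _ c p.1 p.2 q.2 (by simp) (by simp [hpq])))
  · simp
  · simp

/-- A virtual crossing under a local maximum can be removed. -/
theorem virt_cap (x : Strand m) (R : Level m) :
    Eqv n (x :: x.flip :: R) [vi 0, ca 0] [ca 0] :=
  -- V1 is available at minima only: a zigzag creates a minimum on the right, and the virtual
  -- crossing is carried around the maxima to it.
  calc
    Eqv n (x :: x.flip :: R) [vi 0, ca 0] [vi 0, cu x.flip 2, ca 1, ca 0] :=
      .moveBack [vi 0] [ca 0] (.zigzag_left x.flip 1)
    Eqv n (x :: x.flip :: R) _ [cu x.flip 2, vi 0, ca 1, ca 0] :=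
      .move [] [ca 1, ca 0] (.far .virt (.cup x.flip) 0 0)
    Eqv n (x :: x.flip :: R) _ [cu x.flip 2, vi 1, ca 0, ca 0] :=
      .move [cu x.flip 2] [ca 0] (.cap_virt 0)
    Eqv n (x :: x.flip :: R) _ [cu x.flip 2, vi 1, ca 2, ca 0] :=
      .move [cu x.flip 2, vi 1] [] (.far .cap .cap 0 0)
    Eqv n (x :: x.flip :: R) _ [cu x.flip 2, vi 2, ca 1, ca 0] :=
      .move [cu x.flip 2] [ca 0] (.cap_virt 1)
    Eqv n (x :: x.flip :: R) _ [cu x 2, ca 1, ca 0] :=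
      .move [] [ca 1, ca 0] (V1_flip x 2)
    Eqv n (x :: x.flip :: R) _ [ca 0] :=
      .move [] [ca 0] (.zigzag_left x 1)

/-- V4 solved for the opposite detour: the pair `vi 0, vi 1` is invertible by V2. -/
theorem virt_detour_left (b : Bool) (x y z : Strand m) (R : Level m) :
    Eqv n (x :: y :: z :: R) [vi 1, vi 0, cr b 1] [cr b 0, vi 1, vi 0] :=
  calc
    Eqv n (x :: y :: z :: R) [vi 1, vi 0, cr b 1] [vi 1, vi 0, cr b 1, vi 0, vi 0] :=
      .moveBack [vi 1, vi 0, cr b 1] [] (.V2 0)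
    Eqv n (x :: y :: z :: R) _ [vi 1, vi 0, cr b 1, vi 0, vi 1, vi 1, vi 0] :=
      .moveBack [vi 1, vi 0, cr b 1, vi 0] [vi 0] (.V2 1)
    Eqv n (x :: y :: z :: R) _ [vi 1, vi 0, vi 0, vi 1, cr b 0, vi 1, vi 0] :=
      .moveBack [vi 1, vi 0] [vi 1, vi 0] (.V4 b 0)
    Eqv n (x :: y :: z :: R) _ [vi 1, vi 1, cr b 0, vi 1, vi 0] :=
      .move [vi 1] [vi 1, cr b 0, vi 1, vi 0] (.V2 0)
    Eqv n (x :: y :: z :: R) _ [cr b 0, vi 1, vi 0] :=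
      .move [] [cr b 0, vi 1, vi 0] (.V2 1)

theorem virt_zero_cross_one (b : Bool) (x y z : Strand m) (R : Level m) :
    Eqv n (x :: y :: z :: R) [vi 0, cr b 1] [vi 1, cr b 0, vi 1, vi 0] :=
  calc
    Eqv n (x :: y :: z :: R) [vi 0, cr b 1] [vi 1, vi 1, vi 0, cr b 1] :=
      .moveBack [] [vi 0, cr b 1] (.V2 1)
    Eqv n (x :: y :: z :: R) _ [vi 1, cr b 0, vi 1, vi 0] :=
      .at [vi 1] [] [] (virt_detour_left b x z y R)

theorem virt_one_cross_zero (b : Bool) (x y z : Strand m) (R : Level m) :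
    Eqv n (x :: y :: z :: R) [vi 1, cr b 0] [vi 0, cr b 1, vi 0, vi 1] :=
  calc
    Eqv n (x :: y :: z :: R) [vi 1, cr b 0] [vi 0, vi 0, vi 1, cr b 0] :=
      .moveBack [] [vi 1, cr b 0] (.V2 0)
    Eqv n (x :: y :: z :: R) _ [vi 0, cr b 1, vi 0, vi 1] :=
      .move [vi 0] [] (.V4 b 0)

/-- If the strands `q` and `p` belong to one component, then `z` may be pulled across the place
where they cross. -/
theorem exchange_left (b : Bool) {q p : Strand m} (z : Strand m) (R : Level m) (h : q.1 = p.1) :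
    Eqv n (q :: p :: z :: R) [cr b 1, cr (!b) 0] [vi 0, cr (!b) 1, cr b 0, vi 1] :=
  -- The inserted pairs make R3 applicable to `z` and a self-crossing of `q` and `p`. After R3 and a
  -- cancellation, the first and last crossings are between `q` and `p`, hence can be virtualized.
  calc
    Eqv n (q :: p :: z :: R) [cr b 1, cr (!b) 0] [cr b 1, cr (!b) 0, cr (!b) 1, cr b 1] :=
      .moveBack [cr b 1, cr (!b) 0] [] (R2_not b 1)
    Eqv n (q :: p :: z :: R) _ [cr b 1, cr (!b) 0, cr (!b) 1, cr (!b) 0, cr b 0, cr b 1] :=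
      .moveBack [cr b 1, cr (!b) 0, cr (!b) 1] [cr b 1] (R2_not b 0)
    Eqv n (q :: p :: z :: R) _ [cr b 1, cr (!b) 1, cr (!b) 0, cr (!b) 1, cr b 0, cr b 1] :=
      .move [cr b 1] [cr b 0, cr b 1] (.R3 (!b) 0)
    Eqv n (q :: p :: z :: R) _ [cr (!b) 0, cr (!b) 1, cr b 0, cr b 1] :=
      .move [] [cr (!b) 0, cr (!b) 1, cr b 0, cr b 1] (.R2 b 1)
    Eqv n (q :: p :: z :: R) _ [vi 0, cr (!b) 1, cr b 0, cr b 1] :=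
      .selfVirtualize [] [cr (!b) 1, cr b 0, cr b 1] [] (z :: R) (!b) h
    Eqv n (q :: p :: z :: R) _ [vi 0, cr (!b) 1, cr b 0, vi 1] :=
      .selfVirtualize [vi 0, cr (!b) 1, cr b 0] [] [z] R b h.symm

/-- The mirror image of `exchange_left`, with `z` coming from the left. -/
theorem exchange_right (b : Bool) {q p : Strand m} (z : Strand m) (R : Level m) (h : q.1 = p.1) :
    Eqv n (z :: q :: p :: R) [cr (!b) 0, cr b 1] [vi 1, cr b 0, cr (!b) 1, vi 0] :=
  calc
    Eqv n (z :: q :: p :: R) [cr (!b) 0, cr b 1] [cr b 1, cr (!b) 1, cr (!b) 0, cr b 1] :=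
      .moveBack [] [cr (!b) 0, cr b 1] (.R2 b 1)
    Eqv n (z :: q :: p :: R) _ [cr b 1, cr b 0, cr (!b) 0, cr (!b) 1, cr (!b) 0, cr b 1] :=
      .moveBack [cr b 1] [cr (!b) 1, cr (!b) 0, cr b 1] (.R2 b 0)
    Eqv n (z :: q :: p :: R) _ [cr b 1, cr b 0, cr (!b) 1, cr (!b) 0, cr (!b) 1, cr b 1] :=
      .move [cr b 1, cr b 0] [cr b 1] (.R3 (!b) 0)
    Eqv n (z :: q :: p :: R) _ [cr b 1, cr b 0, cr (!b) 1, cr (!b) 0] :=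
      .move [cr b 1, cr b 0, cr (!b) 1, cr (!b) 0] [] (R2_not b 1)
    Eqv n (z :: q :: p :: R) _ [vi 1, cr b 0, cr (!b) 1, cr (!b) 0] :=
      .selfVirtualize [] [cr b 0, cr (!b) 1, cr (!b) 0] [z] R b h
    Eqv n (z :: q :: p :: R) _ [vi 1, cr b 0, cr (!b) 1, vi 0] :=
      .selfVirtualize [vi 1, cr b 0, cr (!b) 1] [] [] (z :: R) (!b) h.symm

/-- Two half twists after a virtual crossing, seen from a bent right strand. -/
theorem bend_right (b : Bool) (x y : Strand m) (R : Level m) :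
    Eqv n (x :: y :: R) [vi 0, cr b 0, cr b 0] [cu y 1, cr b 0, cr (!b) 1, vi 2, ca 1] :=
  calc
    Eqv n (x :: y :: R) [vi 0, cr b 0, cr b 0] [vi 0, cr b 0, cr b 0, cu y 0, ca 1] :=
      .moveBack [vi 0, cr b 0, cr b 0] [] (.zigzag_right y 0)
    Eqv n (x :: y :: R) _ [vi 0, cr b 0, cu y 0, cr b 2, ca 1] :=
      .moveBack [vi 0, cr b 0] [ca 1] (.far (.cup y) (.cross b) 0 0)
    Eqv n (x :: y :: R) _ [vi 0, cu y 0, cr b 2, cr b 2, ca 1] :=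
      .moveBack [vi 0] [cr b 2, ca 1] (.far (.cup y) (.cross b) 0 0)
    Eqv n (x :: y :: R) _ [cu y 0, vi 2, cr b 2, cr b 2, ca 1] :=
      .moveBack [] [cr b 2, cr b 2, ca 1] (.far (.cup y) .virt 0 0)
    Eqv n (x :: y :: R) _ [cu y 0, vi 2, cr b 2, cr (!b) 1, ca 2] :=
      .moveBack [cu y 0, vi 2, cr b 2] [] (cap_cross_not b 1)
    -- The arcs `y.flip` and `y` belong to the bent strand, so `x` can be pulled across their
    -- crossing. Of the two virtual self-crossings created, one is absorbed by the maximum at once,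
    -- the other after a detour past the classical crossings.
    Eqv n (x :: y :: R) _ [cu y 0, vi 2, vi 1, cr (!b) 2, cr b 1, vi 2, ca 2] :=
      .at [cu y 0, vi 2] [ca 2] [y] (exchange_left b (q := y.flip) (p := y) x R rfl)
    Eqv n (x :: y :: R) _ [cu y 0, vi 2, vi 1, cr (!b) 2, cr b 1, ca 2] :=
      .at [cu y 0, vi 2, vi 1, cr (!b) 2, cr b 1] [] [y, x] (virt_cap y R)
    Eqv n (x :: y :: R) _ [cu y 0, vi 2, vi 1, cr (!b) 2, cr (!b) 2, ca 1] :=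
      .move [cu y 0, vi 2, vi 1, cr (!b) 2] [] (.cap_cross b 1)
    Eqv n (x :: y :: R) _ [cu y 0, cr (!b) 1, vi 2, vi 1, cr (!b) 2, ca 1] :=
      .at [cu y 0] [cr (!b) 2, ca 1] [y] (virt_detour_left (!b) y.flip x y R)
    Eqv n (x :: y :: R) _ [cu y 0, cr (!b) 1, cr (!b) 1, vi 2, vi 1, ca 1] :=
      .at [cu y 0, cr (!b) 1] [ca 1] [y] (virt_detour_left (!b) x y.flip y R)
    Eqv n (x :: y :: R) _ [cu y 0, cr (!b) 1, cr (!b) 1, vi 2, ca 1] :=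
      .at [cu y 0, cr (!b) 1, cr (!b) 1, vi 2] [] [y] (virt_cap y.flip (x :: R))
    Eqv n (x :: y :: R) _ [cu y 1, cr b 0, cr (!b) 1, vi 2, ca 1] :=
      .move [] [cr (!b) 1, vi 2, ca 1] (cup_cross_not y b 0)

/-- Two half twists before a virtual crossing, seen from a bent left strand. -/
theorem bend_left (b : Bool) (x y : Strand m) (R : Level m) :
    Eqv n (x :: y :: R) [cr b 0, cr b 0, vi 0] [cu x.flip 1, vi 2, cr (!b) 1, cr b 0, ca 1] :=
  calc
    Eqv n (x :: y :: R) [cr b 0, cr b 0, vi 0] [cu x.flip 1, ca 0, cr b 0, cr b 0, vi 0] :=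
      .moveBack [] [cr b 0, cr b 0, vi 0] (.zigzag_left x.flip 0)
    Eqv n (x :: y :: R) _ [cu x.flip 1, cr b 2, ca 0, cr b 0, vi 0] :=
      .move [cu x.flip 1] [cr b 0, vi 0] (.far .cap (.cross b) 0 0)
    Eqv n (x :: y :: R) _ [cu x.flip 1, cr b 2, cr b 2, ca 0, vi 0] :=
      .move [cu x.flip 1, cr b 2] [vi 0] (.far .cap (.cross b) 0 0)
    Eqv n (x :: y :: R) _ [cu x.flip 1, cr b 2, cr b 2, vi 2, ca 0] :=
      .move [cu x.flip 1, cr b 2, cr b 2] [] (.far .cap .virt 0 0)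
    Eqv n (x :: y :: R) _ [cu x.flip 2, cr (!b) 1, cr b 2, vi 2, ca 0] :=
      .move [] [cr b 2, vi 2, ca 0] (.cup_cross x.flip b 1)
    -- As in `bend_right`, but both new virtual self-crossings are absorbed by the minimum, the
    -- second one after V4 has brought it down.
    Eqv n (x :: y :: R) _ [cu x.flip 2, vi 2, cr b 1, cr (!b) 2, vi 1, vi 2, ca 0] :=
      .at [cu x.flip 2] [vi 2, ca 0] [x] (exchange_right b (q := x.flip) (p := x) y R rfl)
    Eqv n (x :: y :: R) _ [cu x 2, cr b 1, cr (!b) 2, vi 1, vi 2, ca 0] :=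
      .move [] [cr b 1, cr (!b) 2, vi 1, vi 2, ca 0] (V1_flip x 2)
    Eqv n (x :: y :: R) _ [cu x 1, cr (!b) 2, cr (!b) 2, vi 1, vi 2, ca 0] :=
      .moveBack [] [cr (!b) 2, vi 1, vi 2, ca 0] (cup_cross_not x b 1)
    Eqv n (x :: y :: R) _ [cu x 1, cr (!b) 2, vi 1, vi 2, cr (!b) 1, ca 0] :=
      .moveBack [cu x 1, cr (!b) 2] [ca 0] (.V4 (!b) 1)
    Eqv n (x :: y :: R) _ [cu x 1, vi 1, vi 2, cr (!b) 1, cr (!b) 1, ca 0] :=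
      .moveBack [cu x 1] [cr (!b) 1, ca 0] (.V4 (!b) 1)
    Eqv n (x :: y :: R) _ [cu x.flip 1, vi 2, cr (!b) 1, cr (!b) 1, ca 0] :=
      .move [] [vi 2, cr (!b) 1, cr (!b) 1, ca 0] (.V1 x 1)
    Eqv n (x :: y :: R) _ [cu x.flip 1, vi 2, cr (!b) 1, cr b 0, ca 1] :=
      .moveBack [cu x.flip 1, vi 2, cr (!b) 1] [] (.cap_cross b 0)

/-- The rotation of a horizontal chain of three crossings. -/
theorem bend_rotate (b : Bool) (x y : Strand m) (R : Level m) :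
    Eqv n (x :: y :: R) [cu y 1, cr b 0, cr (!b) 1, vi 2, ca 1]
      [cu x.flip 1, vi 2, cr (!b) 1, cr b 0, ca 1] :=
  -- Planar isotopy only: a new bend of `x` is created, the events are reordered by height, and the
  -- bend of `y` is straightened.
  calc
    Eqv n (x :: y :: R) [cu y 1, cr b 0, cr (!b) 1, vi 2, ca 1]
        [cu y 1, cr b 0, cu x.flip 2, ca 1, cr (!b) 1, vi 2, ca 1] :=
      .moveBack [cu y 1, cr b 0] [cr (!b) 1, vi 2, ca 1] (.zigzag_left x.flip 1)
    Eqv n (x :: y :: R) _ [cu y 1, cr b 0, cu x.flip 2, cr (!b) 3, ca 1, vi 2, ca 1] :=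
      .move [cu y 1, cr b 0, cu x.flip 2] [vi 2, ca 1] (.far .cap (.cross (!b)) 1 0)
    Eqv n (x :: y :: R) _ [cu y 1, cr b 0, cu x.flip 3, cr b 2, ca 1, vi 2, ca 1] :=
      .move [cu y 1, cr b 0] [ca 1, vi 2, ca 1] (cup_cross_not x.flip b 2)
    Eqv n (x :: y :: R) _ [cu y 1, cr b 0, cu x.flip 3, cr b 2, vi 4, ca 1, ca 1] :=
      .move [cu y 1, cr b 0, cu x.flip 3, cr b 2] [ca 1] (.far .cap .virt 1 1)
    Eqv n (x :: y :: R) _ [cu y 1, cu x.flip 3, cr b 0, cr b 2, vi 4, ca 1, ca 1] :=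
      .move [cu y 1] [cr b 2, vi 4, ca 1, ca 1] (.far (.cross b) (.cup x.flip) 0 1)
    Eqv n (x :: y :: R) _ [cu x.flip 1, cu y 1, cr b 0, cr b 2, vi 4, ca 1, ca 1] :=
      .move [] [cr b 0, cr b 2, vi 4, ca 1, ca 1] (.far (.cup y) (.cup x.flip) 1 0)
    Eqv n (x :: y :: R) _ [cu x.flip 1, cu y 1, cr b 2, cr b 0, vi 4, ca 1, ca 1] :=
      .move [cu x.flip 1, cu y 1] [vi 4, ca 1, ca 1] (.far (.cross b) (.cross b) 0 0)
    Eqv n (x :: y :: R) _ [cu x.flip 1, cu y 1, cr b 2, vi 4, cr b 0, ca 1, ca 1] :=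
      .move [cu x.flip 1, cu y 1, cr b 2] [ca 1, ca 1] (.far (.cross b) .virt 0 2)
    Eqv n (x :: y :: R) _ [cu x.flip 1, cu y 1, vi 4, cr b 2, cr b 0, ca 1, ca 1] :=
      .move [cu x.flip 1, cu y 1] [cr b 0, ca 1, ca 1] (.far (.cross b) .virt 2 0)
    Eqv n (x :: y :: R) _ [cu x.flip 1, cu y 1, vi 4, cr b 2, cr b 0, ca 3, ca 1] :=
      .move [cu x.flip 1, cu y 1, vi 4, cr b 2, cr b 0] [] (.far .cap .cap 1 0)
    Eqv n (x :: y :: R) _ [cu x.flip 1, cu y 1, vi 4, cr b 2, ca 3, cr b 0, ca 1] :=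
      .move [cu x.flip 1, cu y 1, vi 4, cr b 2] [ca 1] (.far (.cross b) .cap 0 1)
    Eqv n (x :: y :: R) _ [cu x.flip 1, vi 2, cu y 1, cr b 2, ca 3, cr b 0, ca 1] :=
      .move [cu x.flip 1] [cr b 2, ca 3, cr b 0, ca 1] (.far (.cup y) .virt 1 1)
    Eqv n (x :: y :: R) _ [cu x.flip 1, vi 2, cu y 1, cr (!b) 3, ca 2, cr b 0, ca 1] :=
      .move [cu x.flip 1, vi 2, cu y 1] [cr b 0, ca 1] (.cap_cross b 2)
    Eqv n (x :: y :: R) _ [cu x.flip 1, vi 2, cr (!b) 1, cu y 1, ca 2, cr b 0, ca 1] :=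
      .move [cu x.flip 1, vi 2] [ca 2, cr b 0, ca 1] (.far (.cup y) (.cross (!b)) 1 0)
    Eqv n (x :: y :: R) _ [cu x.flip 1, vi 2, cr (!b) 1, cr b 0, ca 1] :=
      .move [cu x.flip 1, vi 2, cr (!b) 1] [cr b 0, ca 1] (.zigzag_right y 1)

/-- A full twist commutes with a virtual crossing up to self-crossing virtualization. -/
theorem virt_full_twist (b : Bool) (x y : Strand m) (R : Level m) :
    Eqv n (x :: y :: R) [vi 0, cr b 0, cr b 0] [cr b 0, cr b 0, vi 0] :=
  (bend_right b x y R).trans ((bend_rotate b x y R).trans (bend_left b x y R).symm)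

/-! ### Commutation of arrows on adjacent strands -/

/-- OC with one crossing moved to the other side of each word by R2; `y` is the overstrand
throughout. -/
theorem overcross_virt (x y z : Strand m) (R : Level m) :
    Eqv n (x :: y :: z :: R) [cr false 0, vi 1, cr true 0] [cr true 1, vi 0, cr false 1] :=
  calc
    Eqv n (x :: y :: z :: R) [cr false 0, vi 1, cr true 0]
        [cr false 0, vi 1, cr true 0, cr true 1, cr false 1] :=
      .moveBack [cr false 0, vi 1, cr true 0] [] (.R2 true 1)
    Eqv n (x :: y :: z :: R) _ [cr false 0, cr true 0, cr true 1, vi 0, cr false 1] :=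
      .moveBack [cr false 0] [cr false 1] (.OC 0)
    Eqv n (x :: y :: z :: R) _ [cr true 1, vi 0, cr false 1] :=
      .move [] [cr true 1, vi 0, cr false 1] (.R2 false 0)

/-- The parallel arrows from `z` to the heads on `x` and `y` commute. -/
theorem over_comm (x z y : Strand m) (R : Level m) :
    Eqv n (x :: z :: y :: R) [cr false 0, vi 0, cr true 1, vi 1]
      [cr true 1, vi 1, cr false 0, vi 0] :=
  calc
    Eqv n (x :: z :: y :: R) [cr false 0, vi 0, cr true 1, vi 1]
        [cr false 0, vi 1, cr true 0, vi 1, vi 0, vi 1] :=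
      .at [cr false 0] [vi 1] [] (virt_zero_cross_one true z x y R)
    Eqv n (x :: z :: y :: R) _ [cr true 1, vi 0, cr false 1, vi 1, vi 0, vi 1] :=
      .at [] [vi 1, vi 0, vi 1] [] (overcross_virt x z y R)
    Eqv n (x :: z :: y :: R) _ [cr true 1, vi 0, cr false 1, vi 0, vi 1, vi 0] :=
      .moveBack [cr true 1, vi 0, cr false 1] [] (.V3 0)
    Eqv n (x :: z :: y :: R) _ [cr true 1, vi 1, cr false 0, vi 0] :=
      .at [cr true 1] [vi 0] [] (.symm (virt_one_cross_zero false x y z R))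

/-- Passing `x` under a virtual crossing is forbidden in general. Here `p` and `q` share a
component, so their crossing may be made classical, R3 applies, and the crossing is made virtual
again. -/
theorem undercross_virt {p q : Strand m} (x : Strand m) (R : Level m) (h : p.1 = q.1) :
    Eqv n (p :: x :: q :: R) [cr false 1, vi 0, cr true 1] [cr true 0, vi 1, cr false 0] :=
  calc
    Eqv n (p :: x :: q :: R) [cr false 1, vi 0, cr true 1]
        [cr false 1, vi 0, cr true 1, cr true 0, cr false 0] :=
      .moveBack [cr false 1, vi 0, cr true 1] [] (.R2 true 0)
    Eqv n (p :: x :: q :: R) _ [cr false 1, cr true 0, cr true 1, cr true 0, cr false 0] :=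
      .symm (.selfVirtualize [cr false 1] [cr true 1, cr true 0, cr false 0] [] (x :: R) true h)
    Eqv n (p :: x :: q :: R) _ [cr false 1, cr true 1, cr true 0, cr true 1, cr false 0] :=
      .move [cr false 1] [cr false 0] (.R3 true 0)
    Eqv n (p :: x :: q :: R) _ [cr true 0, cr true 1, cr false 0] :=
      .move [] [cr true 0, cr true 1, cr false 0] (.R2 false 1)
    Eqv n (p :: x :: q :: R) _ [cr true 0, vi 1, cr false 0] :=
      .selfVirtualize [cr true 0] [cr false 0] [x] R true h

/-- The arrows from the strands `p` and `q` of one component to `x` commute. -/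
theorem under_comm {p q : Strand m} (x : Strand m) (R : Level m) (h : p.1 = q.1) :
    Eqv n (p :: x :: q :: R) [cr false 1, vi 1, cr true 0, vi 0]
      [cr true 0, vi 0, cr false 1, vi 1] :=
  calc
    Eqv n (p :: x :: q :: R) [cr false 1, vi 1, cr true 0, vi 0]
        [cr false 1, vi 0, cr true 1, vi 0, vi 1, vi 0] :=
      .at [cr false 1] [vi 0] [] (virt_one_cross_zero true p q x R)
    Eqv n (p :: x :: q :: R) _ [cr true 0, vi 1, cr false 0, vi 0, vi 1, vi 0] :=
      .at [] [vi 0, vi 1, vi 0] [] (undercross_virt x R h)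
    Eqv n (p :: x :: q :: R) _ [cr true 0, vi 1, cr false 0, vi 1, vi 0, vi 1] :=
      .move [cr true 0, vi 1, cr false 0] [] (.V3 0)
    Eqv n (p :: x :: q :: R) _ [cr true 0, vi 0, cr false 1, vi 1] :=
      .at [cr true 0] [vi 1] [] (.symm (virt_zero_cross_one false x p q R))

end Eqv


/-! ### Powers of arrows and reversal of orientations -/

/-- The word `u` repeated `j` times. -/
def pow (u : Word m) (j : ℕ) : Word m := (List.replicate j u).flatten

@[simp] theorem pow_zero (u : Word m) : pow u 0 = [] := rfl

theorem pow_succ (u : Word m) (j : ℕ) : pow u (j + 1) = u ++ pow u j := rfl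

theorem pow_succ' (u : Word m) (j : ℕ) : pow u (j + 1) = pow u j ++ u := by
  induction j with
  | zero => simp [pow_succ]
  | succ j ih => rw [pow_succ, ih, ← List.append_assoc, ← pow_succ, ih]

theorem sh_pow (k : ℕ) (u : Word m) (j : ℕ) : sh k (pow u j) = pow (sh k u) j := by
  simp [sh, pow, List.map_flatten, List.map_replicate]

theorem run_pow {u : Word m} {L : Level m} (h : run u L = some L) (j : ℕ) :
    run (pow u j) L = some L := by
  induction j with
  | zero => rfl
  | succ j ih => rw [pow_succ, run_append, h]; exact ih

namespace Eqv

theorem pow_comm {L : Level m} {u v : Word m} (hu : run u L = some L)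
    (h : Eqv n L (u ++ v) (v ++ u)) (j : ℕ) : Eqv n L (pow u j ++ v) (v ++ pow u j) := by
  induction j with
  | zero => simpa using refl L v
  | succ j ih =>
    have h₁ := ctx u [] hu ih
    have h₂ := ctx [] (pow u j) rfl h
    simp only [List.append_nil, List.nil_append, ← List.append_assoc] at h₁ h₂
    simpa only [pow_succ, List.append_assoc] using h₁.trans (by simpa using h₂)

theorem pow_inv {L : Level m} {u v : Word m} (hu : run u L = some L)
    (h : Eqv n L (u ++ v) []) (j : ℕ) : Eqv n L (pow u j ++ pow v j) [] := by
  induction j with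
  | zero => exact refl _ _
  | succ j ih =>
    have h₁ := ctx (pow u j) (pow v j) (run_pow hu j) h
    rw [pow_succ' u, pow_succ v]
    simpa using h₁.trans (by simpa using ih)

/-- Parallel arrows vanish if their inverses do. -/
theorem pow_of_inv {L : Level m} {u v : Word m} (hu : run u L = some L)
    (h : Eqv n L (u ++ v) []) {j : ℕ} (hv : Eqv n L (pow v j) []) : Eqv n L (pow u j) [] := by
  have h₁ := ctx (pow u j) [] (run_pow hu j) hv
  simp only [List.append_nil] at h₁
  exact h₁.symm.trans (pow_inv hu h j)

theorem cross_virt_inv (b : Bool) (x y : Strand m) (R : Level m) :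
    Eqv n (x :: y :: R) ([cr b 0, vi 0] ++ [vi 0, cr (!b) 0]) [] :=
  calc
    Eqv n (x :: y :: R) [cr b 0, vi 0, vi 0, cr (!b) 0] [cr b 0, cr (!b) 0] :=
      .move [cr b 0] [cr (!b) 0] (.V2 0)
    Eqv n (x :: y :: R) _ [] :=
      .move [] [] (.R2 b 0)

/-- Between the minimum and the maximum the arrows lie on the reversed arc of `x`. In the induction
the top arrow goes around the maximum to the other arc (`h₁`), down past the remaining arrows (`h₂`)
and out below the minimum (`h₃`). The bent strand lies under `y`, so `over_comm` gives `h₂`. -/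
theorem pow_bend_left (x y : Strand m) (R : Level m) (j : ℕ) :
    Eqv n (x :: y :: R) ([cu x 0, vi 2] ++ pow [cr false 1, vi 1] j ++ [vi 2, ca 1])
      (pow [vi 0, cr true 0] j) := by
  induction j with
  | zero =>
    exact
      calc
        Eqv n (x :: y :: R) [cu x 0, vi 2, vi 2, ca 1] [cu x 0, ca 1] :=
          .move [cu x 0] [ca 1] (.V2 2)
        Eqv n (x :: y :: R) _ [] :=
          .move [] [] (.zigzag_right x 0)
  | succ j ih =>
    have h₁ : Eqv n (x :: x.flip :: y :: x :: R) [cr false 1, vi 1, vi 2, ca 1]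
        [cr true 2, vi 2, vi 2, ca 1] :=
      calc
        Eqv n (x :: x.flip :: y :: x :: R) [cr false 1, vi 1, vi 2, ca 1]
            [cr false 1, vi 1, vi 1, ca 2] :=
          .moveBack [cr false 1, vi 1] [] (.cap_virt 1)
        Eqv n (x :: x.flip :: y :: x :: R) _ [cr false 1, ca 2] :=
          .move [cr false 1] [ca 2] (.V2 1)
        Eqv n (x :: x.flip :: y :: x :: R) _ [cr true 2, ca 1] :=
          .move [] [] (.cap_cross false 1)
        Eqv n (x :: x.flip :: y :: x :: R) _ [cr true 2, vi 2, vi 2, ca 1] :=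
          .moveBack [cr true 2] [ca 1] (.V2 2)
    have h₂ : Eqv n (x :: x.flip :: y :: x :: R) (pow [cr false 1, vi 1] j ++ [cr true 2, vi 2])
        ([cr true 2, vi 2] ++ pow [cr false 1, vi 1] j) :=
      pow_comm rfl (.at [] [] [x] (over_comm x.flip y x R)) j
    have h₃ : Eqv n (x :: y :: R) [cu x 0, vi 2, cr true 2, vi 2]
        [vi 0, cr true 0, cu x 0, vi 2] :=
      calc
        Eqv n (x :: y :: R) [cu x 0, vi 2, cr true 2, vi 2] [vi 0, cu x 0, cr true 2, vi 2] :=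
          .move [] [cr true 2, vi 2] (.far (.cup x) .virt 0 0)
        Eqv n (x :: y :: R) _ [vi 0, cr true 0, cu x 0, vi 2] :=
          .move [vi 0] [vi 2] (.far (.cup x) (.cross true) 0 0)
    have hr : run [cu x 0, vi 2] (x :: y :: R) = some (x :: x.flip :: y :: x :: R) := rfl
    have hp : run ([cu x 0, vi 2] ++ pow [cr false 1, vi 1] j) (x :: y :: R) =
        some (x :: x.flip :: y :: x :: R) := by
      rw [run_append, hr]
      exact run_pow rfl j
    have e₁ := ctx _ [] hp h₁
    have e₂ := ctx _ [vi 2, ca 1] hr h₂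
    have e₃ := ctx [] (pow [cr false 1, vi 1] j ++ [vi 2, ca 1]) rfl h₃
    have e₄ := ctx (L := x :: y :: R) [vi 0, cr true 0] [] rfl ih
    rw [pow_succ', pow_succ]
    simp only [List.append_assoc, List.cons_append, List.nil_append, List.append_nil]
      at e₁ e₂ e₃ e₄ ⊢
    exact e₁.trans (e₂.trans (e₃.trans e₄))

/-- The same for the overstrand. Now two arcs of `y` pass over `x`, and their arrows commute by
`under_comm`, since the arcs belong to one component. -/
theorem pow_bend_right (x y : Strand m) (R : Level m) (j : ℕ) :
    Eqv n (x :: y :: R) ([cu y.flip 2, vi 0] ++ pow [cr false 1, vi 1] j ++ [vi 0, ca 1])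
      (pow [vi 0, cr true 0] j) := by
  induction j with
  | zero =>
    exact
      calc
        Eqv n (x :: y :: R) [cu y.flip 2, vi 0, vi 0, ca 1] [cu y.flip 2, ca 1] :=
          .move [cu y.flip 2] [ca 1] (.V2 0)
        Eqv n (x :: y :: R) _ [] :=
          .move [] [] (.zigzag_left y.flip 1)
  | succ j ih =>
    have h₁ : Eqv n (y :: x :: y.flip :: y :: R) [cr false 1, vi 1, vi 0, ca 1]
        [cr true 0, vi 0, vi 0, ca 1] :=
      calc
        Eqv n (y :: x :: y.flip :: y :: R) [cr false 1, vi 1, vi 0, ca 1]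
            [cr false 1, vi 1, vi 1, ca 0] :=
          .move [cr false 1, vi 1] [] (.cap_virt 0)
        Eqv n (y :: x :: y.flip :: y :: R) _ [cr false 1, ca 0] :=
          .move [cr false 1] [ca 0] (.V2 1)
        Eqv n (y :: x :: y.flip :: y :: R) _ [cr true 0, ca 1] :=
          .moveBack [] [] (.cap_cross true 0)
        Eqv n (y :: x :: y.flip :: y :: R) _ [cr true 0, vi 0, vi 0, ca 1] :=
          .moveBack [cr true 0] [ca 1] (.V2 0)
    have h₂ : Eqv n (y :: x :: y.flip :: y :: R) (pow [cr false 1, vi 1] j ++ [cr true 0, vi 0])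
        ([cr true 0, vi 0] ++ pow [cr false 1, vi 1] j) :=
      pow_comm rfl (under_comm (p := y) (q := y.flip) x (y :: R) rfl) j
    have h₃ : Eqv n (x :: y :: R) [cu y.flip 2, vi 0, cr true 0, vi 0]
        [vi 0, cr true 0, cu y.flip 2, vi 0] :=
      calc
        Eqv n (x :: y :: R) [cu y.flip 2, vi 0, cr true 0, vi 0]
            [vi 0, cu y.flip 2, cr true 0, vi 0] :=
          .moveBack [] [cr true 0, vi 0] (.far .virt (.cup y.flip) 0 0)
        Eqv n (x :: y :: R) _ [vi 0, cr true 0, cu y.flip 2, vi 0] :=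
          .moveBack [vi 0] [vi 0] (.far (.cross true) (.cup y.flip) 0 0)
    have hr : run [cu y.flip 2, vi 0] (x :: y :: R) = some (y :: x :: y.flip :: y :: R) := by simp
    have hp : run ([cu y.flip 2, vi 0] ++ pow [cr false 1, vi 1] j) (x :: y :: R) =
        some (y :: x :: y.flip :: y :: R) := by
      rw [run_append, hr]
      exact run_pow rfl j
    have e₁ := ctx _ [] hp h₁
    have e₂ := ctx _ [vi 0, ca 1] hr h₂
    have e₃ := ctx [] (pow [cr false 1, vi 1] j ++ [vi 0, ca 1]) rfl h₃
    have e₄ := ctx (L := x :: y :: R) [vi 0, cr true 0] [] rfl ih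
    rw [pow_succ', pow_succ]
    simp only [List.append_assoc, List.cons_append, List.nil_append, List.append_nil]
      at e₁ e₂ e₃ e₄ ⊢
    exact e₁.trans (e₂.trans (e₃.trans e₄))

/-- The arrows on the bent strand vanish by hypothesis, and the case of exponent 0 straightens the
empty bend. This kills the power of the inverse arrow, hence the power itself. -/
theorem pow_arrow_flip_left {x y : Strand m} {R : Level m}
    (h : ∀ R, Eqv n (x.flip :: y :: R) (pow [cr false 0, vi 0] n) []) :
    Eqv n (x :: y :: R) (pow [cr false 0, vi 0] n) [] := by
  refine pow_of_inv rfl (cross_virt_inv false x y R) ((pow_bend_left x y R n).symm.trans ?_)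
  calc
    Eqv n (x :: y :: R) _ [cu x 0, vi 2, vi 2, ca 1] :=
      .at [cu x 0, vi 2] [vi 2, ca 1] [x] (h (x :: R)) (by simp only [sh_pow]; rfl)
    Eqv n (x :: y :: R) _ [] := pow_bend_left x y R 0

theorem pow_arrow_flip_right {x y : Strand m} {R : Level m}
    (h : ∀ R, Eqv n (x :: y.flip :: R) (pow [cr false 0, vi 0] n) []) :
    Eqv n (x :: y :: R) (pow [cr false 0, vi 0] n) [] := by
  refine pow_of_inv rfl (cross_virt_inv false x y R) ((pow_bend_right x y R n).symm.trans ?_)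
  calc
    Eqv n (x :: y :: R) _ [cu y.flip 2, vi 0, vi 0, ca 1] :=
      .at [cu y.flip 2, vi 0] [vi 0, ca 1] [y] (h (y :: R)) (by simp only [sh_pow]; rfl)
    Eqv n (x :: y :: R) _ [] := pow_bend_right x y R 0

/-- The `V^n`-move for arbitrary orientations of the two strands. -/
theorem pow_arrow_false (x y : Strand m) (R : Level m) :
    Eqv n (x :: y :: R) (pow [cr false 0, vi 0] n) [] := by
  have up (i j : Fin m) (R : Level m) :
      Eqv n ((i, true) :: (j, true) :: R) (pow [cr false 0, vi 0] n) [] := by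
    refine symm (Relation.EqvGen.rel _ _ ⟨[], [], _, [], _, _, rfl, rfl,
      run_pow (u := [cr false 0, vi 0]) rfl n, ?_, rfl, ?_⟩)
    · exact .inr (.inr (.mk _ 0 i j rfl rfl))
    · simp [pow]
  have left (i j : Fin m) (d : Bool) (R : Level m) :
      Eqv n ((i, d) :: (j, true) :: R) (pow [cr false 0, vi 0] n) [] := by
    cases d with
    | true => exact up i j R
    | false => exact pow_arrow_flip_left fun R => up i j R
  obtain ⟨i, d⟩ := x
  obtain ⟨j, d'⟩ := y
  cases d' with
  | true => exact left i j d R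
  | false => exact pow_arrow_flip_right fun R => left i j d R

theorem pow_virt_conj (b : Bool) (x y : Strand m) (R : Level m) (j : ℕ) :
    Eqv n (x :: y :: R) (pow [vi 0, cr b 0] j) ([vi 0] ++ pow [cr b 0, vi 0] j ++ [vi 0]) := by
  induction j with
  | zero => exact .moveBack [] [] (.V2 0)
  | succ j ih =>
    have e₁ := ctx (L := x :: y :: R) [vi 0, cr b 0] [] rfl ih
    have hw : pow (m := m) [vi 0, cr b 0] (j + 1) = [vi 0, cr b 0] ++ pow [vi 0, cr b 0] j ++ [] := by
      simp [pow_succ]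
    rw [hw]
    convert e₁ using 1
    simp [pow_succ]

theorem pow_arrow_rev_false (x y : Strand m) (R : Level m) :
    Eqv n (x :: y :: R) (pow [vi 0, cr false 0] n) [] := by
  refine (pow_virt_conj false x y R n).trans ((ctx [vi 0] [vi 0] rfl (pow_arrow_false y x R)).trans ?_)
  exact .move [] [] (.V2 0)

/-- For `true`, the inverse arrow `[vi 0, cr false 0]` is a conjugate of the `false` arrow with the
strands interchanged. -/
theorem pow_arrow (b : Bool) (x y : Strand m) (R : Level m) :
    Eqv n (x :: y :: R) (pow [cr b 0, vi 0] n) [] := by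
  cases b with
  | false => exact pow_arrow_false x y R
  | true => exact pow_of_inv rfl (cross_virt_inv true x y R) (pow_arrow_rev_false x y R)

theorem pow_arrow_rev (b : Bool) (x y : Strand m) (R : Level m) :
    Eqv n (x :: y :: R) (pow [vi 0, cr b 0] n) [] := by
  refine (pow_virt_conj b x y R n).trans ((ctx [vi 0] [vi 0] rfl (pow_arrow b y x R)).trans ?_)
  exact .move [] [] (.V2 0)

/-! ### The `2n`-move from arrows -/

/-- The innermost factors merge into a full twist by V2; it commutes with arrows by
`virt_full_twist` and is pulled out to the front. -/
theorem pow_full_twist (b : Bool) (x y : Strand m) (R : Level m) (j : ℕ) :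
    Eqv n (x :: y :: R) (pow [cr b 0, vi 0] j ++ pow [vi 0, cr b 0] j)
      (pow [cr b 0, cr b 0] j) := by
  induction j with
  | zero => exact refl _ _
  | succ j ih =>
    have h₁ : Eqv n (x :: y :: R) [cr b 0, vi 0, vi 0, cr b 0] [cr b 0, cr b 0] :=
      .move [cr b 0] [cr b 0] (.V2 0)
    have h₂ : Eqv n (x :: y :: R) [cr b 0, vi 0, cr b 0, cr b 0] [cr b 0, cr b 0, cr b 0, vi 0] :=
      .at [cr b 0] [] [] (virt_full_twist b y x R)
    have h₃ := pow_comm (u := [cr b 0, vi 0]) (v := [cr b 0, cr b 0]) rfl h₂ j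
    have e₁ := ctx _ (pow [vi 0, cr b 0] j) (run_pow (u := [cr b 0, vi 0]) rfl j) h₁
    have e₂ := ctx [] (pow [vi 0, cr b 0] j) rfl h₃
    have e₃ := ctx (L := x :: y :: R) [cr b 0, cr b 0] [] rfl ih
    rw [pow_succ', pow_succ, pow_succ]
    simp only [List.append_assoc, List.cons_append, List.nil_append, List.append_nil]
      at e₁ e₂ e₃ ⊢
    exact e₁.trans (e₂.trans e₃)

/-- The `2n`-move for arbitrary orientations of the two strands. -/
theorem pow_twist (b : Bool) (x y : Strand m) (R : Level m) :
    Eqv n (x :: y :: R) (pow [cr b 0, cr b 0] n) [] := by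
  refine (pow_full_twist b x y R n).symm.trans ?_
  have h := ctx (pow [cr b 0, vi 0] n) [] 
    (run_pow (u := [cr b 0, vi 0]) rfl n) (pow_arrow_rev (n := n) b x y R)
  simp only [List.append_nil] at h
  exact h.trans (pow_arrow b x y R)

end Eqv

theorem replicate_two_mul (e : Event m × ℕ) (j : ℕ) :
    List.replicate (2 * j) e = pow [e, e] j := by
  induction j with
  | zero => rfl
  | succ j ih => rw [pow_succ, ← ih]; rfl

theorem run_cross_isSome {b : Bool} {k : ℕ} {w : Word m} {L : Level m}
    (h : (run (cr b k :: w) L).isSome) :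
    ∃ (P R : Level m) (x y : Strand m), P.length = k ∧ L = P ++ x :: y :: R := by
  have h' : ((Event.cross b).step k L).isSome := by
    obtain ⟨L', hL⟩ := Option.isSome_iff_exists.1 h
    obtain ⟨M, hM, -⟩ := Option.bind_eq_some_iff.1 hL
    simp [hM]
  clear h
  induction k generalizing L with
  | zero =>
    match L, h' with
    | x :: y :: R, _ => exact ⟨[], R, x, y, rfl, rfl⟩
  | succ k ih =>
    match L, h' with
    | z :: L, h' =>
      obtain ⟨P, R, x, y, hP, rfl⟩ := ih (L := L) (by simpa using h')
      exact ⟨z :: P, R, x, y, by simp [hP], rfl⟩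

theorem TwoNMove.eqv (hn : 0 < n) {L : Level m} {u u' : Word m} (h : TwoNMove n L u u')
    (hr : (run u' L).isSome) : Eqv n L u u' := by
  obtain ⟨k, b⟩ := h
  have hL : ∃ (P R : Level m) (x y : Strand m), P.length = k ∧ L = P ++ x :: y :: R := by
    -- Positivity of `n` ensures that a crossing is present, which forces two strands at position
    -- `k`.
    obtain ⟨j, rfl⟩ : ∃ j, n = j + 1 := ⟨n - 1, by omega⟩
    exact run_cross_isSome hr
  obtain ⟨P, R, x, y, rfl, rfl⟩ := hL
  have := ((Eqv.pow_twist (n := n) b x y R).shift P).symm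
  rw [sh_pow] at this
  rw [replicate_two_mul]
  simpa [sh] using this

/-! Colourings of the points of a diagram which are constant along strands. A diagram without closed
components is one in which such a colouring is determined at the bottom. -/

/-- The colouring above a crossing at position `k`. -/
def swapAt (k : ℕ) (f : ℕ → Prop) (p : ℕ) : Prop :=
  if p = k then f (k + 1) else if p = k + 1 then f k else f p

/-- The colouring above a local minimum at position `k` with colour `c`. -/
def insertAt (k : ℕ) (c : Prop) (f : ℕ → Prop) (p : ℕ) : Prop :=
  if p < k then f p else if p < k + 2 then c else f (p - 2)

/-- The colourings `f` and `g` below and above an event fit together. -/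
def ColStep : Event m → ℕ → (ℕ → Prop) → (ℕ → Prop) → Prop
  | .cross _, k, f, g => g = swapAt k f
  | .virt, k, f, g => g = swapAt k f
  | .cup _, k, f, g => ∃ c, g = insertAt k c f
  | .cap, k, f, g => ∃ c, f = insertAt k c g

/-- The colourings `f` and `g` below and above a word extend to the word. -/
def ColRun : Word m → (ℕ → Prop) → (ℕ → Prop) → Prop
  | [], f, g => f = g
  | (e, k) :: w, f, g => ∃ h, ColStep e k f h ∧ ColRun w h g

theorem colRun_append (a b : Word m) (f g : ℕ → Prop) :
    ColRun (a ++ b) f g ↔ ∃ h, ColRun a f h ∧ ColRun b h g := by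
  induction a generalizing f with
  | nil => simp [ColRun]
  | cons x a ih =>
    simp only [List.cons_append, ColRun, ih]
    constructor
    · rintro ⟨h, h₁, h', h₂, h₃⟩
      exact ⟨h', ⟨h, h₁, h₂⟩, h₃⟩
    · rintro ⟨h', ⟨h, h₁, h₂⟩, h₃⟩
      exact ⟨h, h₁, h', h₂, h₃⟩

theorem swapAt_swapAt (k : ℕ) (f : ℕ → Prop) : swapAt k (swapAt k f) = f := by
  funext p; simp only [swapAt]; grind

theorem swapAt_braid (k : ℕ) (f : ℕ → Prop) :
    swapAt k (swapAt (k + 1) (swapAt k f)) = swapAt (k + 1) (swapAt k (swapAt (k + 1) f)) := by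
  funext p; simp only [swapAt]; grind

theorem swapAt_swapAt_far (k j : ℕ) (f : ℕ → Prop) :
    swapAt (k + 2 + j) (swapAt k f) = swapAt k (swapAt (k + 2 + j) f) := by
  funext p; simp only [swapAt]; grind

theorem swapAt_insertAt (k : ℕ) (c : Prop) (f : ℕ → Prop) :
    swapAt k (insertAt k c f) = insertAt k c f := by
  funext p; simp only [swapAt, insertAt]; grind

theorem swapAt_succ_insertAt (k : ℕ) (c : Prop) (f : ℕ → Prop) :
    swapAt (k + 1) (insertAt k c f) = swapAt k (insertAt (k + 1) c f) := by
  funext p; simp only [swapAt, insertAt]; grind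

theorem swapAt_insertAt_right (k j : ℕ) (c : Prop) (f : ℕ → Prop) :
    swapAt (k + 2 + j) (insertAt k c f) = insertAt k c (swapAt (k + j) f) := by
  funext p; simp only [swapAt, insertAt]; grind

theorem swapAt_insertAt_left (k j : ℕ) (c : Prop) (f : ℕ → Prop) :
    swapAt k (insertAt (k + 2 + j) c f) = insertAt (k + 2 + j) c (swapAt k f) := by
  funext p; simp only [swapAt, insertAt]; grind

theorem insertAt_insertAt (k j : ℕ) (c d : Prop) (f : ℕ → Prop) :
    insertAt (k + 2 + j) d (insertAt k c f) = insertAt k c (insertAt (k + j) d f) := by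
  funext p; simp only [insertAt]; grind

theorem eq_insertAt_of_insertAt_eq {k j : ℕ} {c d : Prop} {f g : ℕ → Prop}
    (h : insertAt (k + 2 + j) d f = insertAt k c g) :
    ∃ h', f = insertAt k c h' ∧ g = insertAt (k + j) d h' := by
  -- The common colouring is `f` with the pair at `k`, `k + 1` deleted.
  refine ⟨fun p => if p < k then f p else f (p + 2), ?_, ?_⟩
  all_goals
    funext p
    have h₁ := congrFun h p
    have h₂ := congrFun h (p + 2)
    have h₃ := congrFun h (p + 4)
    simp only [insertAt] at h₁ h₂ h₃ ⊢
    grind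

theorem zigzag_left_col (k : ℕ) (f g : ℕ → Prop) :
    (∃ c d, insertAt (k + 1) c f = insertAt k d g) ↔ f = g := by
  constructor
  · rintro ⟨c, d, h⟩
    have a₀ := congrFun h k
    have a₁ := congrFun h (k + 1)
    have a₂ := congrFun h (k + 2)
    funext p
    have h₁ := congrFun h p
    have h₂ := congrFun h (p + 2)
    simp only [insertAt] at a₀ a₁ a₂ h₁ h₂
    grind
  · rintro rfl
    refine ⟨f k, f k, ?_⟩
    funext p
    simp only [insertAt]
    grind

theorem WeldedMove.colRun_far (e e' : Event m) (k j : ℕ) (f g : ℕ → Prop) :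
    ColRun [(e, k), (e', k + e.outs + j)] f g ↔ ColRun [(e', k + e.ins + j), (e, k)] f g := by
  cases e <;> cases e' <;>
    simp only [ColRun, ColStep, Event.ins, Event.outs, add_zero, exists_eq_left,
      exists_eq_right]
  case cross.cross | cross.virt | virt.cross | virt.virt => rw [swapAt_swapAt_far]
  case cross.cup | virt.cup =>
    constructor
    · rintro ⟨c, rfl⟩
      exact ⟨_, ⟨c, rfl⟩, swapAt_insertAt_left ..⟩
    · rintro ⟨_, ⟨c, rfl⟩, rfl⟩
      exact ⟨c, swapAt_insertAt_left ..⟩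
  case cup.cross | cup.virt =>
    constructor
    · rintro ⟨_, ⟨c, rfl⟩, rfl⟩
      exact ⟨c, swapAt_insertAt_right ..⟩
    · rintro ⟨c, rfl⟩
      exact ⟨_, ⟨c, rfl⟩, swapAt_insertAt_right ..⟩
  case cup.cup =>
    constructor
    · rintro ⟨_, ⟨c, rfl⟩, d, rfl⟩
      exact ⟨_, ⟨d, rfl⟩, c, insertAt_insertAt ..⟩
    · rintro ⟨_, ⟨d, rfl⟩, c, rfl⟩
      exact ⟨_, ⟨c, rfl⟩, d, (insertAt_insertAt ..).symm⟩
  case cap.cap =>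
    constructor
    · rintro ⟨_, ⟨c, rfl⟩, d, rfl⟩
      exact ⟨_, ⟨d, (insertAt_insertAt ..).symm⟩, c, rfl⟩
    · rintro ⟨_, ⟨d, rfl⟩, c, rfl⟩
      exact ⟨_, ⟨c, insertAt_insertAt ..⟩, d, rfl⟩
  case cup.cap =>
    constructor
    · rintro ⟨_, ⟨c, rfl⟩, d, h⟩
      obtain ⟨h', rfl, rfl⟩ := eq_insertAt_of_insertAt_eq h.symm
      exact ⟨_, ⟨d, rfl⟩, c, rfl⟩
    · rintro ⟨h', ⟨d, rfl⟩, c, rfl⟩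
      exact ⟨_, ⟨c, rfl⟩, d, (insertAt_insertAt ..).symm⟩
  case cap.cup =>
    constructor
    · rintro ⟨h', ⟨c, rfl⟩, d, rfl⟩
      exact ⟨_, ⟨d, rfl⟩, c, insertAt_insertAt ..⟩
    · rintro ⟨_, ⟨d, rfl⟩, c, h⟩
      obtain ⟨h', rfl, rfl⟩ := eq_insertAt_of_insertAt_eq h
      exact ⟨_, ⟨c, rfl⟩, d, rfl⟩
  case cross.cap | virt.cap =>
    constructor
    · rintro ⟨c, h⟩
      refine ⟨swapAt k g, ⟨c, ?_⟩, swapAt_swapAt _ _⟩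
      rw [← swapAt_insertAt_left, ← h, swapAt_swapAt]
    · rintro ⟨_, ⟨c, rfl⟩, rfl⟩
      exact ⟨c, swapAt_insertAt_left ..⟩
  case cap.cross | cap.virt =>
    constructor
    · rintro ⟨h', ⟨c, rfl⟩, rfl⟩
      exact ⟨c, swapAt_insertAt_right ..⟩
    · rintro ⟨c, h⟩
      refine ⟨swapAt (k + j) g, ⟨c, ?_⟩, swapAt_swapAt _ _⟩
      rw [← swapAt_insertAt_right, ← h, swapAt_swapAt]

/-- The relation between bottom and top colourings records only which ends are joined, and the moves
preserve this. -/
theorem WeldedMove.colRun {u u' : Word m} (h : WeldedMove u u') (f g : ℕ → Prop) :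
    ColRun u f g ↔ ColRun u' f g := by
  have rot (k : ℕ) (f g : ℕ → Prop) :
      (∃ c, swapAt k f = insertAt (k + 1) c g) ↔ ∃ c, swapAt (k + 1) f = insertAt k c g := by
    refine exists_congr fun c => ⟨fun h => ?_, fun h => ?_⟩
    · rw [← swapAt_swapAt k f, h, ← swapAt_succ_insertAt, swapAt_swapAt]
    · rw [← swapAt_swapAt (k + 1) f, h, swapAt_succ_insertAt, swapAt_swapAt]
  cases h with
  | far e e' k j => exact colRun_far e e' k j f g
  | zigzag_left s k =>
    simpa [ColRun, ColStep] using zigzag_left_col k f g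
  | zigzag_right s k =>
    have := zigzag_left_col k g f
    simp only [ColRun, ColStep]
    rw [@eq_comm _ f g, ← this]
    constructor
    · rintro ⟨_, ⟨c, rfl⟩, _, ⟨d, h⟩, rfl⟩
      exact ⟨d, c, h.symm⟩
    · rintro ⟨d, c, h⟩
      exact ⟨_, ⟨c, rfl⟩, _, ⟨d, h.symm⟩, rfl⟩
  | cup_cross s b k => simp [ColRun, ColStep, swapAt_succ_insertAt]
  | cup_virt s k => simp [ColRun, ColStep, swapAt_succ_insertAt]
  | cap_cross b k => simpa [ColRun, ColStep] using rot k f g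
  | cap_virt k => simpa [ColRun, ColStep] using rot k f g
  | R1 s b k => simp [ColRun, ColStep, swapAt_insertAt, eq_comm]
  | R2 b k => simp [ColRun, ColStep, swapAt_swapAt]
  | R3 b k => simp [ColRun, ColStep, swapAt_braid]
  | V1 s k => simp [ColRun, ColStep, swapAt_insertAt, eq_comm]
  | V2 k => simp [ColRun, ColStep, swapAt_swapAt]
  | V3 k => simp [ColRun, ColStep, swapAt_braid]
  | V4 b k => simp [ColRun, ColStep, swapAt_braid]
  | OC k => simp [ColRun, ColStep, swapAt_braid]

theorem Basic.colRun {L : Level m} {u u' : Word m} (h : Basic n L u u') (f g : ℕ → Prop) :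
    ColRun u f g ↔ ColRun u' f g := by
  rcases h with h | h | h
  · exact h.colRun f g
  · cases h
    rfl
  · obtain ⟨k, i, j, -, -⟩ := h
    have (j : ℕ) : ColRun (m := m) [] f g ↔ ColRun (m := m) (pow [cr false k, vi k] j) f g := by
      induction j with
      | zero => rfl
      | succ j ih => simp [pow_succ, ColRun, ColStep, swapAt_swapAt, ← ih]
    exact this n

/-! ### Local moves create no closed components -/

/-- All colourings of the word which are constantly true at both ends are constantly true. -/
def LocallyConnected (u : Word m) : Prop :=
  ∀ p s, u = p ++ s → ∀ h, ColRun p ⊤ h → ColRun s h ⊤ → h = ⊤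

theorem swapAt_top (k : ℕ) : swapAt k ⊤ = ⊤ := by
  funext p; simp [swapAt]

theorem insertAt_true_top (k : ℕ) : insertAt k True ⊤ = ⊤ := by
  funext p; simp [insertAt]

theorem eq_top_of_insertAt {k : ℕ} {c : Prop} {f : ℕ → Prop} (h : insertAt k c f = ⊤) : f = ⊤ := by
  funext p
  have h₁ := congrFun h p
  have h₂ := congrFun h (p + 2)
  simp only [insertAt, Pi.top_apply] at h₁ h₂ ⊢
  grind

theorem colRun_top_of_no_cup {w : Word m} (hw : ∀ s k, (Event.cup s, k) ∉ w) {h : ℕ → Prop}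
    (hc : ColRun w ⊤ h) : h = ⊤ := by
  induction w with
  | nil => exact hc.symm
  | cons x w ih =>
    obtain ⟨e, k⟩ := x
    obtain ⟨h', h₁, h₂⟩ := hc
    obtain rfl : h' = ⊤ := by
      cases e with
      | cross b => exact h₁.trans (swapAt_top k)
      | virt => exact h₁.trans (swapAt_top k)
      | cup s => exact absurd (by simp) (hw s k)
      | cap =>
        obtain ⟨c, hc⟩ := h₁
        exact eq_top_of_insertAt hc.symm
    exact ih (fun s k hs => hw s k (by simp [hs])) h₂

theorem locallyConnected_of_no_cup {w : Word m} (hw : ∀ s k, (Event.cup s, k) ∉ w) :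
    LocallyConnected w := by
  rintro p s rfl h hp -
  exact colRun_top_of_no_cup (fun s k hs => hw s k (by simp [hs])) hp

theorem locallyConnected_singleton (x : Event m × ℕ) : LocallyConnected [x] := by
  intro p s hps h hp hs
  rcases p with _ | ⟨y, p⟩
  · exact hp.symm
  · obtain ⟨-, h'⟩ := List.cons.inj hps
    obtain ⟨rfl, rfl⟩ := List.append_eq_nil_iff.1 h'.symm
    exact hs

/-- The excluded case is a circle made of a minimum and the maximum directly above it. -/
theorem locallyConnected_pair {e e' : Event m} {k k' : ℕ}
    (hne : (∃ s, e = .cup s) → e' = .cap → k ≠ k') :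
    LocallyConnected [(e, k), (e', k')] := by
  intro p s hps h hp hs
  match p, hps with
  | [], _ => exact hp.symm
  | [_], hps =>
    obtain ⟨rfl, rfl⟩ := List.cons.inj hps
    obtain ⟨_, h₁, rfl⟩ := hp
    obtain ⟨_, h₂, rfl⟩ := hs
    rename_i h
    by_cases he : ∃ s, e = .cup s
    · obtain ⟨s, rfl⟩ := he
      obtain ⟨c, rfl⟩ := h₁
      cases e' with
      | cross b =>
        have := congrArg (swapAt k') h₂
        rwa [swapAt_swapAt, swapAt_top, eq_comm] at this
      | virt =>
        have := congrArg (swapAt k') h₂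
        rwa [swapAt_swapAt, swapAt_top, eq_comm] at this
      | cup s =>
        obtain ⟨d, hd⟩ := h₂
        exact eq_top_of_insertAt hd.symm
      | cap =>
        obtain ⟨d, hd⟩ := h₂
        -- As the positions differ, one branch of the minimum avoids the maximum and reaches the
        -- top, where the colour is true.
        have hc : c := by
          have hk := hne ⟨s, rfl⟩ rfl
          have h₁ := congrFun hd k
          have h₂ := congrFun hd (k + 1)
          simp only [insertAt, Pi.top_apply, Prop.top_eq_true] at h₁ h₂
          grind
        rw [eq_true hc]
        exact insertAt_true_top k
    · exact colRun_top_of_no_cup (w := [(e, k)]) (by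
        intro s k hs
        simp only [List.mem_singleton, Prod.mk.injEq] at hs
        exact he ⟨s, hs.1.symm⟩) ⟨_, h₁, rfl⟩
  | [_, _], hps =>
    obtain ⟨-, h'⟩ := List.cons.inj hps
    obtain ⟨-, rfl⟩ := List.cons.inj h'
    exact hs
  | _ :: _ :: _ :: _, hps => simp at hps

theorem Basic.locallyConnected {L : Level m} {u u' : Word m} (h : Basic n L u u') :
    LocallyConnected u ∧ LocallyConnected u' := by
  rcases h with h | h | h
  · cases h with
    | far e e' k j =>
      refine ⟨locallyConnected_pair ?_, locallyConnected_pair ?_⟩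
      · rintro ⟨s, rfl⟩ -
        simp only [Event.outs]
        omega
      · rintro ⟨s, rfl⟩ rfl
        simp only [Event.ins]
        omega
    | zigzag_left s k | zigzag_right s k =>
      exact ⟨locallyConnected_pair (by simp), locallyConnected_of_no_cup (by simp)⟩
    | cup_cross s b k | cup_virt s k =>
      exact ⟨locallyConnected_pair (by simp), locallyConnected_pair (by simp)⟩
    | R1 s b k | V1 s k =>
      exact ⟨locallyConnected_pair (by simp), locallyConnected_singleton _⟩
    | _ => exact ⟨locallyConnected_of_no_cup (by simp), locallyConnected_of_no_cup (by simp)⟩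
  · cases h
    exact ⟨locallyConnected_singleton _, locallyConnected_singleton _⟩
  · cases h
    refine ⟨locallyConnected_of_no_cup (by simp), locallyConnected_of_no_cup ?_⟩
    simp

/-- All colourings of the word which are constantly true at the bottom are constantly true. -/
def Connected (w : Word m) : Prop :=
  ∀ p s, w = p ++ s → ∀ h g, ColRun p ⊤ h → ColRun s h g → h = ⊤

/-- Colourings of the new word transfer to the old one outside the replaced part. In particular the
two levels bounding `u'` are constantly true, and `hu` covers the levels inside. -/
theorem Connected.replace {a u u' b : Word m} (hw : Connected (a ++ u ++ b))
    (h : ∀ f g, ColRun u' f g → ColRun u f g) (hu : LocallyConnected u') :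
    Connected (a ++ u' ++ b) := by
  intro p s hps f g hp hs
  rw [List.append_assoc, List.append_eq_append_iff] at hps
  rcases hps with ⟨c, rfl, hc⟩ | ⟨c, rfl, rfl⟩
  · simp only [colRun_append] at hp
    obtain ⟨h₁, ha, hp⟩ := hp
    rw [List.append_eq_append_iff] at hc
    rcases hc with ⟨d, rfl, rfl⟩ | ⟨d, rfl, rfl⟩
    · obtain ⟨h₂, hu', hd⟩ := (colRun_append _ _ _ _).1 hp
      refine hw (a ++ u ++ d) s (by simp) f g ?_ hs
      simp only [colRun_append]
      exact ⟨h₂, ⟨h₁, ha, h _ _ hu'⟩, hd⟩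
    · obtain ⟨h₂, hd, hb⟩ := (colRun_append _ _ _ _).1 hs
      have hu' := h _ _ ((colRun_append _ _ _ _).2 ⟨_, hp, hd⟩)
      obtain rfl : h₁ = ⊤ :=
        hw a (u ++ b) (by simp) _ g ha ((colRun_append _ _ _ _).2 ⟨_, hu', hb⟩)
      obtain rfl : h₂ = ⊤ :=
        hw (a ++ u) b rfl _ g ((colRun_append _ _ _ _).2 ⟨_, ha, hu'⟩) hb
      exact hu c d rfl f hp hd
  · simp only [colRun_append] at hs
    obtain ⟨h₁, hc, h₂, hu', hb⟩ := hs
    refine hw p (c ++ u ++ b) (by simp) f g hp ?_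
    simp only [colRun_append]
    exact ⟨h₂, ⟨h₁, hc, h _ _ hu'⟩, hb⟩

/-! ### Colourings versus connection by strands -/

/-- A sequence of colourings of the levels of a word which fit together. -/
def Chain (w : Word m) (c : ℕ → ℕ → Prop) : Prop :=
  ∀ t e k, w[t]? = some (e, k) → ColStep e k (c t) (c (t + 1))

theorem Chain.colRun {w : Word m} {c : ℕ → ℕ → Prop} (h : Chain w c) :
    ColRun w (c 0) (c w.length) := by
  induction w generalizing c with
  | nil => rfl
  | cons x w ih =>
    exact ⟨c 1, h 0 x.1 x.2 rfl, ih (c := fun t => c (t + 1)) fun t e k ht => h (t + 1) e k ht⟩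

theorem Chain.colRun_left {p s : Word m} {c : ℕ → ℕ → Prop} (h : Chain (p ++ s) c) :
    ColRun p (c 0) (c p.length) := by
  refine Chain.colRun fun t e k ht => h t e k ?_
  rw [List.getElem?_append_left (List.getElem?_eq_some_iff.1 ht).1, ht]

theorem Chain.colRun_right {p s : Word m} {c : ℕ → ℕ → Prop} (h : Chain (p ++ s) c) :
    ∃ g, ColRun s (c p.length) g := by
  refine ⟨_, Chain.colRun (c := fun t => c (p.length + t)) fun t e k ht => h _ e k ?_⟩
  rw [List.getElem?_append_right (by omega), Nat.add_sub_cancel_left, ht]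

theorem exists_chain (p : Word m) {s : Word m} {f h g : ℕ → Prop} (hp : ColRun p f h)
    (hs : ColRun s h g) : ∃ c, Chain (p ++ s) c ∧ c 0 = f ∧ c p.length = h := by
  have cons (e : Event m) (k : ℕ) (w : Word m) (f : ℕ → Prop) (c : ℕ → ℕ → Prop)
      (hc : Chain w c) (he : ColStep e k f (c 0)) :
      Chain ((e, k) :: w) (fun t => Nat.casesOn t f c) := by
    rintro (_ | t) e' k' ht
    · obtain ⟨rfl, rfl⟩ := Prod.mk.inj (Option.some.inj ht)
      exact he
    · exact hc t e' k' ht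
  induction p generalizing f with
  | nil =>
    obtain rfl := hp
    induction s generalizing f with
    | nil => exact ⟨fun _ => f, fun t e k ht => by simp at ht, rfl, rfl⟩
    | cons x s ih =>
      obtain ⟨h', h₁, h₂⟩ := hs
      obtain ⟨c, hc, rfl, -⟩ := ih h₂
      exact ⟨_, cons x.1 x.2 s f c hc h₁, rfl, rfl⟩
  | cons x p ih =>
    obtain ⟨h', h₁, h₂⟩ := hp
    obtain ⟨c, hc, rfl, hc'⟩ := ih h₂
    exact ⟨_, cons x.1 x.2 (p ++ s) f c hc h₁, rfl, hc'⟩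

theorem Chain.adj {w : Word m} {c : ℕ → ℕ → Prop} (h : Chain w c) {q q' : ℕ × ℕ}
    (hq : Adj w q q') : c q.1 q.2 = c q'.1 q'.2 := by
  cases hq with
  | @left t p k e ht hp =>
    have := h t e k ht
    cases e <;> simp only [ColStep] at this
    case cap =>
      obtain ⟨d, hd⟩ := this
      simp [hd, insertAt, hp]
    case cup =>
      obtain ⟨d, hd⟩ := this
      simp [hd, insertAt, hp]
    all_goals
      simp only [this, swapAt]
      grind
  | @right t p k e ht =>
    have := h t e k ht
    cases e <;> simp only [ColStep] at this
    case cap =>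
      obtain ⟨d, hd⟩ := this
      simp only [hd, insertAt, Event.ins, Event.outs]
      grind
    case cup =>
      obtain ⟨d, hd⟩ := this
      simp only [hd, insertAt, Event.ins, Event.outs]
      grind
    all_goals
      simp only [this, swapAt, Event.ins, Event.outs]
      grind
  | @cross_right t k b ht =>
    have h' : c (t + 1) = swapAt k (c t) := h t _ k ht
    simp [h', swapAt]
  | @cross_left t k b ht =>
    have h' : c (t + 1) = swapAt k (c t) := h t _ k ht
    simp [h', swapAt]
  | @virt_right t k ht =>
    have h' : c (t + 1) = swapAt k (c t) := h t _ k ht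
    simp [h', swapAt]
  | @virt_left t k ht =>
    have h' : c (t + 1) = swapAt k (c t) := h t _ k ht
    simp [h', swapAt]
  | @cup t k s ht =>
    obtain ⟨d, hd⟩ := h t _ k ht
    simp [hd, insertAt]
  | @cap t k ht =>
    obtain ⟨d, hd⟩ := h t _ k ht
    simp [hd, insertAt]

/-- With `Chain.adj`: chains are exactly the functions on points that are constant along strands. -/
theorem chain_of_adj {w : Word m} {c : ℕ → ℕ → Prop}
    (h : ∀ q q', Adj w q q' → c q.1 q.2 = c q'.1 q'.2) : Chain w c := by
  intro t e k ht
  have hl (p : ℕ) (hp : p < k) : c t p = c (t + 1) p := h _ _ (.left ht hp)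
  have hr (p : ℕ) : c t (k + e.ins + p) = c (t + 1) (k + e.outs + p) := h _ _ (.right ht)
  have swap (h₀ : e.ins = 2) (h₁ : e.outs = 2) (h₂ : c t k = c (t + 1) (k + 1))
      (h₃ : c t (k + 1) = c (t + 1) k) : c (t + 1) = swapAt k (c t) := by
    funext p
    rw [h₀, h₁] at hr
    have a := hl p
    have b := hr (p - (k + 2))
    simp only [swapAt]
    grind
  cases e with
  | cross b => exact swap rfl rfl (h _ _ (.cross_right ht)) (h _ _ (.cross_left ht))
  | virt => exact swap rfl rfl (h _ _ (.virt_right ht)) (h _ _ (.virt_left ht))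
  | cup s =>
    have h₀ : c (t + 1) k = c (t + 1) (k + 1) := h _ _ (.cup ht)
    refine ⟨c (t + 1) k, funext fun p => ?_⟩
    have a := hl p
    have b := hr (p - (k + 2))
    simp only [insertAt, Event.ins, Event.outs] at b ⊢
    grind
  | cap =>
    have h₀ : c t k = c t (k + 1) := h _ _ (.cap ht)
    refine ⟨c t k, funext fun p => ?_⟩
    have a := hl p
    have b := hr (p - (k + 2))
    simp only [insertAt, Event.ins, Event.outs] at b ⊢
    grind

theorem Event.step_length {e : Event m} {k : ℕ} {L L' : Level m} (h : e.step k L = some L') :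
    k + e.ins ≤ L.length ∧ L'.length + e.ins = L.length + e.outs := by
  induction k generalizing L L' with
  | zero =>
    cases e with
    | cup s =>
      obtain rfl := Option.some.inj h
      simp
    | cap =>
      match L, h with
      | x :: y :: L, h =>
        simp only [step_cap, Option.ite_none_right_eq_some, Option.some.injEq] at h
        simp [← h.2]
    | _ =>
      match L, h with
      | x :: y :: L, h =>
        obtain rfl := Option.some.inj h
        simp
  | succ k ih =>
    match L, h with
    | x :: L, h =>
      simp only [step_succ, Option.map_eq_some_iff] at h
      obtain ⟨M, hM, rfl⟩ := h
      have := ih hM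
      simp only [List.length_cons]
      omega
    | [], h => cases e <;> simp [Event.step] at h

/-- The number of strands at the level below the event number `t`. -/
def width (w : Word m) (t : ℕ) : ℕ := ((run (w.take t) (boundary m)).getD []).length

theorem width_zero (w : Word m) : width w 0 = m := by simp [width, boundary]

theorem width_eq {w : Word m} {t : ℕ} {L : Level m} (h : run (w.take t) (boundary m) = some L) :
    width w t = L.length := by
  simp [width, h]

theorem width_succ {w : Word m} (hw : run w (boundary m) = some (boundary m)) {t k : ℕ}
    {e : Event m} (ht : w[t]? = some (e, k)) :
    k + e.ins ≤ width w t ∧ width w (t + 1) + e.ins = width w t + e.outs := by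
  have h₁ : w = w.take (t + 1) ++ w.drop (t + 1) := (List.take_append_drop _ _).symm
  rw [h₁, run_append, Option.bind_eq_some_iff] at hw
  obtain ⟨L', hL', -⟩ := hw
  have h₂ := hL'
  rw [List.take_add_one, ht, run_append, Option.bind_eq_some_iff] at h₂
  obtain ⟨L, hL, h₂⟩ := h₂
  rw [width_eq hL, width_eq hL']
  obtain ⟨M, hM, hM'⟩ := Option.bind_eq_some_iff.1 h₂
  obtain rfl : M = L' := by simpa using hM'
  exact Event.step_length hM

/-- `Adj.right` also joins phantom positions to the right of all strands; these never meet actual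
points. -/
theorem Adj.lt_width {w : Word m} (hw : run w (boundary m) = some (boundary m)) {q q' : ℕ × ℕ}
    (h : Adj w q q') : q.2 < width w q.1 ↔ q'.2 < width w q'.1 := by
  cases h with
  | left ht hp =>
    have := width_succ hw ht
    simp only
    omega
  | right ht =>
    have := width_succ hw ht
    simp only
    omega
  | cross_right ht | cross_left ht | virt_right ht | virt_left ht | cup ht | cap ht =>
    have := width_succ hw ht
    simp only [Event.ins, Event.outs] at this ⊢
    omega

/-- The diagrams without closed components, in terms of colourings. -/
theorem connected_iff {w : Word m} (hw : run w (boundary m) = some (boundary m)) :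
    (∀ t ≤ w.length, ∀ L : Level m, run (w.take t) (boundary m) = some L →
      ∀ p < L.length, ∃ i < m, Relation.EqvGen (Adj w) (0, i) (t, p)) ↔ Connected w := by
  constructor
  · rintro H p s rfl h g hp hs
    obtain ⟨c, hc, h0, rfl⟩ := exists_chain p hp hs
    have inside {t q i : ℕ} (hr : Relation.EqvGen (Adj (p ++ s)) (0, i) (t, q)) : c t q := by
      have key : ∀ a b : ℕ × ℕ, Relation.EqvGen (Adj (p ++ s)) a b → c a.1 a.2 = c b.1 b.2 := by
        intro a b hab
        induction hab with
        | rel _ _ h => exact hc.adj h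
        | refl => rfl
        | symm _ _ _ ih => exact ih.symm
        | trans _ _ _ _ _ ih ih' => exact ih.trans ih'
      have h' := key _ _ hr
      simp only [h0] at h'
      rw [← h']
      trivial
    -- Phantom positions are traced straight down to the bottom, where the colour is true.
    have outside (t : ℕ) (ht : t ≤ (p ++ s).length) :
        ∀ q, width (p ++ s) t ≤ q → c t q := by
      induction t with
      | zero =>
        intro q _
        rw [h0]
        trivial
      | succ t ih =>
        intro q hq
        obtain ⟨⟨e, k⟩, hek⟩ : ∃ x, (p ++ s)[t]? = some x :=
          ⟨_, List.getElem?_eq_getElem (by omega)⟩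
        have h₁ := width_succ hw hek
        obtain ⟨r, rfl⟩ : ∃ r, q = k + e.outs + r := ⟨q - (k + e.outs), by omega⟩
        have h₂ := hc.adj (Adj.right (p := r) hek)
        simp only at h₂
        rw [← h₂]
        exact ih (by omega) _ (by omega)
    funext q
    refine eq_true ?_
    have hw' := hw
    rw [run_append, Option.bind_eq_some_iff] at hw'
    obtain ⟨L, hL, -⟩ := hw'
    have hL' : run ((p ++ s).take p.length) (boundary m) = some L := by
      rw [List.take_left, hL]
    by_cases hq : q < L.length
    · obtain ⟨i, -, hi⟩ := H p.length (by simp) L hL' q hq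
      exact inside hi
    · exact outside _ (by simp) q (by rw [width_eq hL']; omega)
  · intro H t ht L hL p hp
    -- Colour by reachability from the bottom. Leaving `i` unbounded makes the bottom colouring `⊤`
    -- on phantom positions too; `i < m` is recovered from `Adj.lt_width`.
    let c : ℕ → ℕ → Prop := fun t p => ∃ i, Relation.EqvGen (Adj w) (0, i) (t, p)
    have hc : Chain w c := by
      refine chain_of_adj fun q q' hq => propext ⟨?_, ?_⟩
      · rintro ⟨i, hi⟩
        exact ⟨i, hi.trans _ _ _ (.rel _ _ hq)⟩
      · rintro ⟨i, hi⟩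
        exact ⟨i, hi.trans _ _ _ (.symm _ _ (.rel _ _ hq))⟩
    have h0 : c 0 = ⊤ := by
      funext i
      exact eq_true ⟨i, .refl _⟩
    have hc' : Chain (w.take t ++ w.drop t) c := by rwa [List.take_append_drop]
    have hlen : (w.take t).length = t := by simp [ht]
    obtain ⟨g, hg⟩ := hc'.colRun_right
    have htop := H (w.take t) (w.drop t) (by simp) _ g (h0 ▸ hc'.colRun_left) hg
    rw [hlen] at htop
    obtain ⟨i, hi⟩ : c t p := by rw [htop]; trivial
    refine ⟨i, ?_, hi⟩
    have key : ∀ a b : ℕ × ℕ, Relation.EqvGen (Adj w) a b →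
        (a.2 < width w a.1 ↔ b.2 < width w b.1) := by
      intro a b hab
      induction hab with
      | rel _ _ h => exact h.lt_width hw
      | refl => rfl
      | symm _ _ _ ih => exact ih.symm
      | trans _ _ _ _ _ ih ih' => exact ih.trans ih'
    have := (key _ _ hi).2 (by simpa only [width_eq hL] using hp)
    simpa only [width_zero] using this

/-! ### From words back to string links -/

/-- The words of the diagrams of string links. -/
def IsDiagram (w : Word m) : Prop :=
  run w (boundary m) = some (boundary m) ∧ Connected w

/-- The diagram of a word. -/
def IsDiagram.diagram {w : Word m} (h : IsDiagram w) : StringLinkDiagram m :=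
  ⟨w, h.1, (connected_iff h.1).2 h.2⟩

theorem StringLinkDiagram.isDiagram (D : StringLinkDiagram m) : IsDiagram D.word :=
  ⟨D.run_word, (connected_iff D.run_word).1 D.no_closed⟩

theorem Step.isDiagram_iff {w w' : Word m} (h : Step n (boundary m) w w') :
    IsDiagram w ↔ IsDiagram w' := by
  have hr : run w (boundary m) = run w' (boundary m) := Eqv.run_eq (Relation.EqvGen.rel _ _ h)
  obtain ⟨a, u, u', b, L₁, L₂, -, -, -, hb, rfl, rfl⟩ := h
  unfold IsDiagram
  rw [hr]
  refine and_congr_right fun _ => ⟨fun h => ?_, fun h => ?_⟩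
  · exact h.replace (fun f g => (hb.colRun f g).2) hb.locallyConnected.2
  · exact h.replace (fun f g => (hb.colRun f g).1) hb.locallyConnected.1

theorem Step.vSvEquivalent {w w' : Word m} (h : Step n (boundary m) w w') (hw : IsDiagram w)
    (hw' : IsDiagram w') : VSvEquivalent n hw.diagram.toLink hw'.diagram.toLink := by
  obtain ⟨a, u, u', b, L₁, L₂, ha, -, -, hb, rfl, rfl⟩ := h
  rcases hb with hb | hb | hb
  · have : hw.diagram.toLink = hw'.diagram.toLink :=
      Quotient.sound (Relation.EqvGen.rel _ _ ⟨a, u, u', b, L₁, ha, hb, rfl, rfl⟩)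
    rw [this]
    exact .refl _
  · exact .rel _ _ (.inr ⟨_, _, rfl, rfl, a, u, u', b, L₁, ha, hb, rfl, rfl⟩)
  · exact .rel _ _ (.inl ⟨_, _, rfl, rfl, a, u, u', b, L₁, ha, hb, rfl, rfl⟩)

theorem Eqv.isDiagram_iff {w w' : Word m} (h : Eqv n (boundary m) w w') :
    IsDiagram w ↔ IsDiagram w' := by
  induction h with
  | rel _ _ h => exact h.isDiagram_iff
  | refl => rfl
  | symm _ _ _ ih => exact ih.symm
  | trans _ _ _ _ _ ih ih' => exact ih.trans ih'

theorem Eqv.vSvEquivalent {w w' : Word m} (h : Eqv n (boundary m) w w') (hw : IsDiagram w)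
    (hw' : IsDiagram w') : VSvEquivalent n hw.diagram.toLink hw'.diagram.toLink := by
  induction h with
  | rel _ _ h => exact h.vSvEquivalent hw hw'
  | refl => exact .refl _
  | symm _ _ _ ih => exact (ih hw' hw).symm
  | trans x y z h _ ih ih' =>
    -- An intermediate word must itself be a diagram to represent a string link.
    have hy : IsDiagram y := (Eqv.isDiagram_iff h).1 hw
    exact (ih hw hy).trans _ _ _ (ih' hy hw')

end Welded

theorem proposition5p1 (m n : ℕ) (hn : 0 < n) (σ σ' : Welded.WeldedStringLink m)
    (h : Welded.TwoNSvEquivalent n σ σ') : Welded.VSvEquivalent n σ σ' := by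
  induction h with
  | rel σ σ' h =>
    rcases h with ⟨D, D', rfl, rfl, a, u, u', b, L, ha, hm, hD, hD'⟩ | h
    · have hr : (Welded.run u' L).isSome := by
        have := D'.run_word
        rw [hD', List.append_assoc, Welded.run_append, ha, Option.bind_some, Welded.run_append,
          Option.bind_eq_some_iff] at this
        obtain ⟨L', hL', -⟩ := this
        simp [hL']
      have he : Welded.Eqv n (Welded.boundary m) D.word D'.word := by
        rw [hD, hD']
        exact Welded.Eqv.ctx a b ha (hm.eqv hn hr)
      exact he.vSvEquivalent D.isDiagram D'.isDiagram
    · exact .rel _ _ (.inr h)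
  | refl => exact .refl _
  | symm _ _ _ ih => exact ih.symm
  | trans _ _ _ _ _ ih ih' => exact ih.trans _ _ _ ih'
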